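/- Let $U\subset\mathbb C^2$ be open, with coordinates $(x,y)$, and let $n,m,\Delta,\Gamma$ be nonnegative integers with $\Delta\le n$ and $\Gamma\le m$. For $a,b\ge 0$ let $\mathcal R_{a,b}\subset C^\infty(U,\mathbb C)$ be the linear span of the monomials $x^iy^j$ with $0\le i\le a$, $0\le j\le b$. Put $(n_1,m_1)=(n-\Delta,m)$ and $(n_2,m_2)=(n,m-\Gamma)$. A $2\times2$ matrix differential operator $D=(D_{ij})$ on $U$ has entries that are finite sums $\sum f_{ab}(x,y)\,\partial_x^a\partial_y^b$ with $f_{ab}\in C^\infty(U,\mathbb C)$, where $\partial_x,\partial_y$ are the (Wirtinger) derivatives with respect to the complex coordinates $x,y$; it has order at most $k$ if only terms with $a+b\le k$ occur in its entries. Let $\tilde{\mathfrak R}$ (the distinguished complement) be the space of those $D$ that map $\mathcal R_{n_1,m_1}\oplus\mathcal R_{n_2,m_2}=\mathcal R_{n-\Delta,m}\oplus\mathcal R_{n,m-\Gamma}$ to itself and for which $D_{ij}$ contains only terms with $a\le n_j$ and $b\le m_j$, for all $i,j\in\{1,2\}$. For $\lambda\in\mathbb C$ let $$J^+_\lambda=x^2\partial_x-\lambda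 x,\quad J^-_\lambda=\partial_x,\quad J^0_\lambda=x\partial_x-\tfrac{\lambda}{2},\qquad K^+_\lambda=y^2\partial_y-\lambda y,\quad K^-_\lambda=\partial_y,\quad K^0_\lambda=y\partial_y-\tfrac{\lambda}{2},$$ and for $\epsilon\in\{+,-,0\}$ let $$S^\epsilon=\operatorname{diag}(J^\epsilon_{n-\Delta},J^\epsilon_n),\qquad T^\epsilon=\operatorname{diag}(K^\epsilon_m,K^\epsilon_{m-\Gamma}),\qquad \tilde J=\operatorname{diag}(1,-1).$$ With $\sigma^+=\begin{pmatrix}0&1\\0&0\end{pmatrix}$, $\sigma^-=\begin{pmatrix}0&0\\1&0\end{pmatrix}$, and for $0\le\alpha\le\Delta$, $0\le\beta\le\Gamma$, let $$Q^+_{\alpha\beta}=\Big(\prod_{l=1}^{\Delta-\alpha}(x\partial_x-n+\Delta-l)\Big)\partial_x^\alpha\; y^\beta\,\sigma^+,\qquad Q^-_{\alpha\beta}=x^\alpha\Big(\prod_{l=1}^{\Gamma-\beta}(y\partial_y-m+\Gamma-l)\Big)\partial_y^\beta\,\sigma^-$$ (empty products are $1$). Let $\mathcal B$ be the set of all monomials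 $$X(S^\mu)^i(S^0)^s(T^\nu)^j(T^0)^t,\quad Q^\varepsilon_{\alpha0}(S^{-\varepsilon})^i(T^\nu)^j(T^0)^t,\quad Q^\varepsilon_{0\beta}(S^\mu)^i(S^0)^s(T^\varepsilon)^j,\quad Q^\varepsilon_{\alpha\beta}(S^{-\varepsilon})^i(T^\varepsilon)^j,$$ where $X\in\{Q^+_{00},Q^-_{00},1,\tilde J\}$, $1$ is the identity matrix, $\mu,\nu,\varepsilon\in\{+,-\}$ are independent signs, $i,j,s,t\ge 0$, $1\le\alpha\le\Delta$ and $1\le\beta\le\Gamma$. Theorem. For every $k\ge 0$, every $D\in\tilde{\mathfrak R}$ of order at most $k$ is a (finite) $\mathbb C$-linear combination of elements of $\mathcal B$ that have order at most $k$. -/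

import Mathlib

open scoped ContDiff

noncomputable section

namespace RectMod

/-- Open subsets of `ℂ²`, with the standard coordinates `(x, y)`. -/
abbrev Dom := TopologicalSpace.Opens (ℂ × ℂ)

/-- Extension by zero of a function on `U`; its germs at the points of `U` are those of `f`. -/
def ext0 (U : Dom) (f : U → ℂ) : ℂ × ℂ → ℂ := Function.extend Subtype.val f 0

theorem ext0_apply (U : Dom) (f : U → ℂ) (p : U) : ext0 U f p = f p :=
  Subtype.val_injective.extend_apply f 0 p

theorem ext0_restrict_eqOn (U : Dom) (g : ℂ × ℂ → ℂ) :
    Set.EqOn (ext0 U (fun p => g p)) g U := fun p hp => ext0_apply U (fun p => g p) ⟨p, hp⟩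

/-- A function on `U` given by a formula that is smooth on `U`. -/
theorem smooth_restrict (U : Dom) {g : ℂ × ℂ → ℂ} (hg : ContDiffOn ℝ ∞ g U) :
    ContDiffOn ℝ ∞ (ext0 U (fun p => g p)) U :=
  hg.congr (ext0_restrict_eqOn U g)

/-- The algebra `C^∞(U, ℂ)` of complex-valued functions on `U` that are infinitely
differentiable in the real sense. -/
def Smooth (U : Dom) : Subalgebra ℂ (U → ℂ) where
  carrier := {f | ContDiffOn ℝ ∞ (ext0 U f) U}
  mul_mem' {f g} hf hg := (hf.mul hg).congr fun p hp => by
    have h := fun q => ext0_apply U q ⟨p, hp⟩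
    dsimp only at h
    rw [h, h, h]; rfl
  add_mem' {f g} hf hg := (hf.add hg).congr fun p hp => by
    have h := fun q => ext0_apply U q ⟨p, hp⟩
    dsimp only at h
    rw [h, h, h]; rfl
  algebraMap_mem' c := smooth_restrict U (g := fun _ => c) contDiffOn_const

/-- The coordinate function `x`. -/
def x (U : Dom) : Smooth U :=
  ⟨fun p => p.1.1, smooth_restrict U (g := fun p => p.1) contDiff_fst.contDiffOn⟩

/-- The coordinate function `y`. -/
def y (U : Dom) : Smooth U :=
  ⟨fun p => p.1.2, smooth_restrict U (g := fun p => p.2) contDiff_snd.contDiffOn⟩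

/-- The complex derivative `(1/2) (∂_v - i ∂_{iv})` along `v`, a `ℂ`-linear operator on
`C^∞(U, ℂ)`. On holomorphic functions it is the usual holomorphic directional derivative. -/
def wirtinger (U : Dom) (v : ℂ × ℂ) : Module.End ℂ (Smooth U) where
  toFun f := ⟨fun p => (1 / 2 : ℂ) * (fderiv ℝ (ext0 U f.1) p v
      - Complex.I * fderiv ℝ (ext0 U f.1) p (Complex.I • v)), by
    have hf : ContDiffOn ℝ ∞ (fderiv ℝ (ext0 U f.1)) U :=
      ContDiffOn.fderiv_of_isOpen f.2 U.isOpen (by simp)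
    exact smooth_restrict U (g := fun p => (1 / 2 : ℂ) * (fderiv ℝ (ext0 U f.1) p v
      - Complex.I * fderiv ℝ (ext0 U f.1) p (Complex.I • v)))
      (contDiffOn_const.mul ((hf.clm_apply contDiffOn_const).sub
        (contDiffOn_const.mul (hf.clm_apply contDiffOn_const))))⟩
  map_add' f g := by
    apply Subtype.ext
    funext p
    have hd : ∀ q : Smooth U, DifferentiableAt ℝ (ext0 U q.1) p := fun q =>
      (q.2.differentiableOn (by simp)).differentiableAt (U.isOpen.mem_nhds p.2)
    have e : ext0 U (f + g).1 =ᶠ[nhds (p : ℂ × ℂ)] (ext0 U f.1 + ext0 U g.1) :=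
      Filter.eventuallyEq_of_mem (U.isOpen.mem_nhds p.2) fun r hr => by
        have h := fun q => ext0_apply U q ⟨r, hr⟩
        simp only [Pi.add_apply] at *
        rw [h, h, h]; rfl
    have e' := e.fderiv_eq (𝕜 := ℝ)
    rw [fderiv_add (hd f) (hd g)] at e'
    dsimp only
    rw [e']
    simp only [Subalgebra.coe_add, Pi.add_apply, add_apply]
    ring
  map_smul' c f := by
    apply Subtype.ext
    funext p
    have hd : DifferentiableAt ℝ (ext0 U f.1) p :=
      (f.2.differentiableOn (by simp)).differentiableAt (U.isOpen.mem_nhds p.2)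
    have e : ext0 U (c • f).1 =ᶠ[nhds (p : ℂ × ℂ)] (c • ext0 U f.1) :=
      Filter.eventuallyEq_of_mem (U.isOpen.mem_nhds p.2) fun r hr => by
        have h := fun q => ext0_apply U q ⟨r, hr⟩
        simp only [Pi.smul_apply] at *
        rw [h, h]; rfl
    have e' := e.fderiv_eq (𝕜 := ℝ)
    rw [fderiv_const_smul hd] at e'
    dsimp only
    rw [e']
    simp only [RingHom.id_apply, Subalgebra.coe_smul, Pi.smul_apply, smul_apply, smul_eq_mul]
    ring

/-- Scalar operators: linear endomorphisms of `C^∞(U, ℂ)`, with composition as product. -/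
abbrev Op (U : Dom) := Module.End ℂ (Smooth U)

/-- `∂/∂x`. -/
def dx (U : Dom) : Op U := wirtinger U (1, 0)

/-- `∂/∂y`. -/
def dy (U : Dom) : Op U := wirtinger U (0, 1)

/-- The operator of multiplication by a smooth function. -/
def mulOp (U : Dom) (f : Smooth U) : Op U := LinearMap.mulLeft ℂ f

/-- `T` is a differential operator `∑ f_{ij} ∂_x^i ∂_y^j`, a finite sum with smooth coefficients
that runs over pairs `(i, j)` with `P i j`. -/
def IsDiffOpOn (U : Dom) (P : ℕ → ℕ → Prop) (T : Op U) : Prop :=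
  ∃ f : ℕ × ℕ →₀ Smooth U, (∀ p ∈ f.support, P p.1 p.2) ∧
    T = f.sum fun p g => mulOp U g * dx U ^ p.1 * dy U ^ p.2

/-- The scalar rectangular module `R_{n,m}`, spanned by `x^i y^j`, `0 ≤ i ≤ n`, `0 ≤ j ≤ m`. -/
def rect (U : Dom) (n m : ℕ) : Submodule ℂ (Smooth U) :=
  Submodule.span ℂ {f | ∃ i j : ℕ, i ≤ n ∧ j ≤ m ∧ f = x U ^ i * y U ^ j}

/-- `2 × 2` matrices of operators. -/
abbrev MatOp (U : Dom) := Matrix (Fin 2) (Fin 2) (Op U)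

/-- The action of a matrix of operators on pairs of functions. -/
def act (U : Dom) (T : MatOp U) (v : Fin 2 → Smooth U) : Fin 2 → Smooth U :=
  fun i => ∑ j, T i j (v j)

/-- The `x`-degree bounds `(n - Δ, n)` of the two components. -/
def xDeg (n Δ : ℕ) : Fin 2 → ℕ := ![n - Δ, n]

/-- The `y`-degree bounds `(m, m - Γ)` of the two components. -/
def yDeg (m Γ : ℕ) : Fin 2 → ℕ := ![m, m - Γ]

/-- The module `R_{n-Δ,m} ⊕ R_{n,m-Γ}`. -/
def rect2 (U : Dom) (n m Δ Γ : ℕ) : Submodule ℂ (Fin 2 → Smooth U) :=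
  Submodule.pi Set.univ fun i => rect U (xDeg n Δ i) (yDeg m Γ i)

/-- `T` is a matrix differential operator of order at most `k`. -/
def OrderLE (U : Dom) (k : ℕ) (T : MatOp U) : Prop :=
  ∀ i j, IsDiffOpOn U (fun a b => a + b ≤ k) (T i j)

/-- The distinguished complement: the matrix differential operators that preserve
`R_{n-Δ,m} ⊕ R_{n,m-Γ}` and whose entries in column `j` contain only derivatives
`∂_x^a ∂_y^b` with `a ≤ n_j`, `b ≤ m_j`, where `R_{n_j,m_j}` is the `j`-th summand. -/
def complementR (U : Dom) (n m Δ Γ : ℕ) : Set (MatOp U) :=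
  {T | (∀ v ∈ rect2 U n m Δ Γ, act U T v ∈ rect2 U n m Δ Γ) ∧
    ∀ i j, IsDiffOpOn U (fun a b => a ≤ xDeg n Δ j ∧ b ≤ yDeg m Γ j) (T i j)}

/-- Signs `±`. -/
inductive Sgn
  | plus
  | minus

/-- The opposite sign. -/
def Sgn.opp : Sgn → Sgn
  | .plus => .minus
  | .minus => .plus

/-- `X² D - c X` for the sign `+`, `D` for the sign `-`. -/
def slPM {A : Type*} [Ring A] [Algebra ℂ A] (X D : A) (c : ℂ) : Sgn → A
  | .plus => X ^ 2 * D - c • X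
  | .minus => D

/-- `X D - c/2`. -/
def slZero {A : Type*} [Ring A] [Algebra ℂ A] (X D : A) (c : ℂ) : A :=
  X * D - algebraMap ℂ A (c / 2)

/-- `∏_{k=1}^{Δ-α} (X D - n + Δ - k) · D^α` (the factors of the product commute). -/
def qbar {A : Type*} [Ring A] [Algebra ℂ A] (X D : A) (n Δ α : ℕ) : A :=
  ((List.range (Δ - α)).map fun k =>
    X * D - algebraMap ℂ A ((n : ℂ) - Δ + ((k : ℂ) + 1))).prod * D ^ α

/-- `S^± = diag(J^±_{n-Δ}, J^±_n)`. -/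
def S (U : Dom) (n Δ : ℕ) (ε : Sgn) : MatOp U :=
  Matrix.diagonal ![slPM (mulOp U (x U)) (dx U) ((n : ℂ) - Δ) ε,
    slPM (mulOp U (x U)) (dx U) n ε]

/-- `S^0 = diag(J^0_{n-Δ}, J^0_n)`. -/
def S0 (U : Dom) (n Δ : ℕ) : MatOp U :=
  Matrix.diagonal ![slZero (mulOp U (x U)) (dx U) ((n : ℂ) - Δ),
    slZero (mulOp U (x U)) (dx U) n]

/-- `T^± = diag(K^±_m, K^±_{m-Γ})`. -/
def T (U : Dom) (m Γ : ℕ) (ε : Sgn) : MatOp U :=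
  Matrix.diagonal ![slPM (mulOp U (y U)) (dy U) m ε,
    slPM (mulOp U (y U)) (dy U) ((m : ℂ) - Γ) ε]

/-- `T^0 = diag(K^0_m, K^0_{m-Γ})`. -/
def T0 (U : Dom) (m Γ : ℕ) : MatOp U :=
  Matrix.diagonal ![slZero (mulOp U (y U)) (dy U) m,
    slZero (mulOp U (y U)) (dy U) ((m : ℂ) - Γ)]

/-- `J̃ = σ₃ = diag(1, -1)`. -/
def Jtilde (U : Dom) : MatOp U := Matrix.diagonal ![1, -1]

/-- `Q^+_{αβ} = q̄_α(x, n, Δ) y^β σ^+` and `Q^-_{αβ} = x^α q̄_β(y, m, Γ) σ^-`, where `σ^+` is the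
matrix unit in position `(1, 2)` and `σ^-` its transpose. -/
def Q (U : Dom) (n m Δ Γ : ℕ) (ε : Sgn) (α β : ℕ) : MatOp U :=
  match ε with
  | .plus => !![0, qbar (mulOp U (x U)) (dx U) n Δ α * mulOp U (y U) ^ β; 0, 0]
  | .minus => !![0, 0; mulOp U (x U) ^ α * qbar (mulOp U (y U)) (dy U) m Γ β, 0]

/-- The four families of monomials; the signs of `S^±` and `T^±` are chosen independently,
and all exponents range over the nonnegative integers. -/
def basisR (U : Dom) (n m Δ Γ : ℕ) : Set (MatOp U) :=
  {M | ∃ X : MatOp U,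
      (X = 1 ∨ X = Jtilde U ∨ ∃ ε : Sgn, X = Q U n m Δ Γ ε 0 0) ∧
      ∃ (μ ν : Sgn) (i s j t : ℕ),
        M = X * S U n Δ μ ^ i * S0 U n Δ ^ s * T U m Γ ν ^ j * T0 U m Γ ^ t} ∪
  {M | ∃ (ε ν : Sgn) (α i j t : ℕ), 1 ≤ α ∧ α ≤ Δ ∧
        M = Q U n m Δ Γ ε α 0 * S U n Δ ε.opp ^ i * T U m Γ ν ^ j * T0 U m Γ ^ t} ∪
  {M | ∃ (ε μ : Sgn) (β i s j : ℕ), 1 ≤ β ∧ β ≤ Γ ∧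
        M = Q U n m Δ Γ ε 0 β * S U n Δ μ ^ i * S0 U n Δ ^ s * T U m Γ ε ^ j} ∪
  {M | ∃ (ε : Sgn) (α β i j : ℕ), 1 ≤ α ∧ α ≤ Δ ∧ 1 ≤ β ∧ β ≤ Γ ∧
        M = Q U n m Δ Γ ε α β * S U n Δ ε.opp ^ i * T U m Γ ε ^ j}

end RectMod

end

noncomputable section

namespace RectMod

/-! The statement is proved entry by entry. An entry is a scalar operator, with derivatives `∂_x^a
∂_y^b` restricted to `a ≤ N`, `b ≤ M`, that maps `R_{N,M}` to `R_{N',M'}`. Such an operator is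
reduced by induction on its order, subtracting products of one-variable operators with the right
leading terms.

The coefficient at `∂_x^a ∂_y^b` is found at a point `(z,w)` by applying the operator to `(x-z)^a
(y-w)^b` (`diffOp_apply_sub_pow`). Expanding binomially and letting the point vary shows that it is
a polynomial. If `a+b` is the top order, multiplying the test function by `x^(N-a) y^(M-b)` only
multiplies the result by the same monomial, so the coefficient is spanned by `x^u y^v` with `u+N ≤
N'+2a`, `v+M ≤ M'+2b` (`top_coeff_mem`). It also vanishes if `N'+a < N` or `M'+b < M`: a nonzero
polynomial of degree at most `N'` cannot be divisible by a higher power `(x-z)^(N-a)`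
(`top_coeff_eq_zero_x`, `top_coeff_eq_zero_y`).

Conversely, each permitted `x^u ∂_x^a` leads an explicit product of an intertwining factor (`x^α` or
`qbar`) and `sl₂` operators that maps degree `N` to degree `N'`; the same holds in `y`
(`exists_raising`, `exists_lowering`). Subtracting the corresponding products lowers the order and
keeps both the mapping property and the bounds on `a`, `b` (`diffOp_mem_span_products`). The
off-diagonal products are themselves elements of the basis, and the diagonal ones are separated by
`1` and `J̃`. -/

/-! ### Wirtinger calculus on smooth functions and its action on `P(x) Q(y)`. -/

theorem smooth_differentiableAt {U : Dom} (f : Smooth U) (p : U) :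
    DifferentiableAt ℝ (ext0 U f.1) p :=
  (f.2.differentiableOn (by simp)).differentiableAt (U.isOpen.mem_nhds p.2)

theorem wirtinger_apply (U : Dom) (v : ℂ × ℂ) (f : Smooth U) (p : U) :
    (wirtinger U v f).1 p = (1 / 2 : ℂ) * (fderiv ℝ (ext0 U f.1) p v
      - Complex.I * fderiv ℝ (ext0 U f.1) p (Complex.I • v)) := rfl

theorem fderiv_ext0 {U : Dom} (f : Smooth U) {g : ℂ × ℂ → ℂ} (h : ∀ p : U, f.1 p = g p) (p : U) :
    fderiv ℝ (ext0 U f.1) p = fderiv ℝ g p := by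
  refine Filter.EventuallyEq.fderiv_eq (Filter.eventuallyEq_of_mem (U.isOpen.mem_nhds p.2) ?_)
  intro r hr
  exact (ext0_apply U f.1 ⟨r, hr⟩).trans (h ⟨r, hr⟩)

theorem wirtinger_mul (U : Dom) (v : ℂ × ℂ) (f g : Smooth U) :
    wirtinger U v (f * g) = f * wirtinger U v g + g * wirtinger U v f := by
  apply Subtype.ext
  funext p
  have e := fderiv_ext0 (f * g) (g := ext0 U f.1 * ext0 U g.1) (fun q => by
    rw [Pi.mul_apply, ext0_apply, ext0_apply]; rfl) p
  rw [fderiv_mul (smooth_differentiableAt f p) (smooth_differentiableAt g p)] at e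
  simp only [Subalgebra.coe_add, Subalgebra.coe_mul, Pi.add_apply, Pi.mul_apply,
    wirtinger_apply]
  rw [Subalgebra.coe_mul] at e
  rw [e]
  simp only [add_apply, smul_apply, smul_eq_mul, ext0_apply]
  ring

theorem wirtinger_x (U : Dom) (v : ℂ × ℂ) : wirtinger U v (x U) = algebraMap ℂ _ v.1 := by
  apply Subtype.ext
  funext p
  rw [wirtinger_apply, fderiv_ext0 (x U) (g := Prod.fst) (fun _ => rfl) p, fderiv_fst]
  simp only [ContinuousLinearMap.coe_fst', Prod.smul_fst, smul_eq_mul]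
  rw [← mul_assoc, Complex.I_mul_I]
  show _ = v.1
  ring

theorem wirtinger_y (U : Dom) (v : ℂ × ℂ) : wirtinger U v (y U) = algebraMap ℂ _ v.2 := by
  apply Subtype.ext
  funext p
  rw [wirtinger_apply, fderiv_ext0 (y U) (g := Prod.snd) (fun _ => rfl) p, fderiv_snd]
  simp only [ContinuousLinearMap.coe_snd', Prod.smul_snd, smul_eq_mul]
  rw [← mul_assoc, Complex.I_mul_I]
  show _ = v.2
  ring

theorem fderiv_wirtinger (U : Dom) (v w : ℂ × ℂ) (f : Smooth U) (p : U) :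
    fderiv ℝ (ext0 U (wirtinger U v f).1) p w =
      (1 / 2 : ℂ) * (fderiv ℝ (fderiv ℝ (ext0 U f.1)) p w v
        - Complex.I * fderiv ℝ (fderiv ℝ (ext0 U f.1)) p w (Complex.I • v)) := by
  rw [fderiv_ext0 (wirtinger U v f) (g := fun q => (1 / 2 : ℂ) * (fderiv ℝ (ext0 U f.1) q v
      - Complex.I * fderiv ℝ (ext0 U f.1) q (Complex.I • v)))
    (fun q => wirtinger_apply U v f q) p]
  have hf : ContDiffOn ℝ ∞ (fderiv ℝ (ext0 U f.1)) U :=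
    ContDiffOn.fderiv_of_isOpen f.2 U.isOpen (by simp)
  have hd : HasFDerivAt (fderiv ℝ (ext0 U f.1)) (fderiv ℝ (fderiv ℝ (ext0 U f.1)) p) p :=
    ((hf.differentiableOn (by simp)).differentiableAt (U.isOpen.mem_nhds p.2)).hasFDerivAt
  have h1 := hd.clm_apply (hasFDerivAt_const v (p : ℂ × ℂ))
  have h2 := hd.clm_apply (hasFDerivAt_const (Complex.I • v) (p : ℂ × ℂ))
  refine (congrArg (fun L => L w)
    ((h1.sub (h2.const_mul Complex.I)).const_mul (1 / 2 : ℂ)).fderiv).trans ?_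
  simp

/-- The second real derivative of a smooth function is symmetric. -/
theorem wirtinger_comm (U : Dom) (v w : ℂ × ℂ) : Commute (wirtinger U v) (wirtinger U w) := by
  refine LinearMap.ext fun f => Subtype.ext (funext fun p => ?_)
  have hs : IsSymmSndFDerivAt ℝ (ext0 U f.1) p :=
    (f.2.contDiffAt (U.isOpen.mem_nhds p.2)).isSymmSndFDerivAt (by
      simp only [minSmoothness_of_isRCLikeNormedField]; exact WithTop.coe_le_coe.2 le_top)
  rw [Module.End.mul_apply, Module.End.mul_apply, wirtinger_apply, wirtinger_apply]
  simp only [fderiv_wirtinger]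
  rw [hs w v, hs w (Complex.I • v), hs (Complex.I • w) v, hs (Complex.I • w) (Complex.I • v)]
  ring

/-- The complex derivative along `v` as a derivation of the algebra of smooth functions. -/
def wirtingerDer (U : Dom) (v : ℂ × ℂ) : Derivation ℂ (Smooth U) (Smooth U) :=
  Derivation.mk' (wirtinger U v) fun f g => wirtinger_mul U v f g

theorem wirtinger_aeval (U : Dom) (v : ℂ × ℂ) (f : Smooth U) (P : Polynomial ℂ) :
    wirtinger U v (Polynomial.aeval f P) =
      Polynomial.aeval f (Polynomial.derivative P) * wirtinger U v f :=
  (wirtingerDer U v).map_aeval P f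

/-- The function `P(x) Q(y)`. -/
def polyProd (U : Dom) (P Q : Polynomial ℂ) : Smooth U :=
  Polynomial.aeval (x U) P * Polynomial.aeval (y U) Q

theorem aeval_val {U : Dom} (f : Smooth U) (P : Polynomial ℂ) (p : U) :
    (Polynomial.aeval f P).1 p = P.eval (f.1 p) := by
  induction P using Polynomial.induction_on' with
  | add P Q hP hQ =>
    simp only [map_add, Subalgebra.coe_add, Pi.add_apply, hP, hQ, Polynomial.eval_add]
  | monomial n c =>
    rw [Polynomial.aeval_monomial, Polynomial.eval_monomial]
    rfl

theorem polyProd_val (U : Dom) (P Q : Polynomial ℂ) (p : U) :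
    (polyProd U P Q).1 p = P.eval p.1.1 * Q.eval p.1.2 := by
  rw [polyProd, Subalgebra.coe_mul, Pi.mul_apply, aeval_val, aeval_val]; rfl

theorem dx_polyProd (U : Dom) (P Q : Polynomial ℂ) :
    dx U (polyProd U P Q) = polyProd U (Polynomial.derivative P) Q := by
  rw [polyProd, polyProd, dx, wirtinger_mul, wirtinger_aeval, wirtinger_aeval, wirtinger_x,
    wirtinger_y]
  simp [mul_comm]

theorem dy_polyProd (U : Dom) (P Q : Polynomial ℂ) :
    dy U (polyProd U P Q) = polyProd U P (Polynomial.derivative Q) := by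
  rw [polyProd, polyProd, dy, wirtinger_mul, wirtinger_aeval, wirtinger_aeval, wirtinger_x,
    wirtinger_y]
  simp

theorem dx_pow_polyProd (U : Dom) (a : ℕ) (P Q : Polynomial ℂ) :
    (dx U ^ a) (polyProd U P Q) = polyProd U (Polynomial.derivative^[a] P) Q := by
  induction a generalizing P with
  | zero => rfl
  | succ a ih => rw [pow_succ, Module.End.mul_apply, dx_polyProd, ih, Function.iterate_succ_apply]

theorem dy_pow_polyProd (U : Dom) (a : ℕ) (P Q : Polynomial ℂ) :
    (dy U ^ a) (polyProd U P Q) = polyProd U P (Polynomial.derivative^[a] Q) := by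
  induction a generalizing Q with
  | zero => rfl
  | succ a ih => rw [pow_succ, Module.End.mul_apply, dy_polyProd, ih, Function.iterate_succ_apply]

/-- Taylor coefficients make it visible which derivatives of a power of `X - z` survive at a point.
-/
theorem eval_iterate_derivative (a : ℕ) (P : Polynomial ℂ) (z : ℂ) :
    (Polynomial.derivative^[a] P).eval z = (a.factorial : ℂ) * (Polynomial.taylor z P).coeff a := by
  rw [Polynomial.taylor_coeff, ← Polynomial.factorial_smul_hasseDeriv]
  simp

theorem mulOp_apply (U : Dom) (g f : Smooth U) : mulOp U g f = g * f := rfl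

theorem mulOp_mul (U : Dom) (f g : Smooth U) : mulOp U (f * g) = mulOp U f * mulOp U g :=
  LinearMap.ext fun h => mul_assoc f g h

theorem mulOp_pow (U : Dom) (f : Smooth U) (n : ℕ) : mulOp U (f ^ n) = mulOp U f ^ n := by
  induction n with
  | zero => exact LinearMap.ext fun h => one_mul h
  | succ n ih => rw [pow_succ, mulOp_mul, ih, pow_succ]

theorem mulOp_comm (U : Dom) (f g : Smooth U) : Commute (mulOp U f) (mulOp U g) :=
  LinearMap.ext fun h => mul_left_comm f g h

theorem wirtinger_mulOp (U : Dom) (v : ℂ × ℂ) (f : Smooth U) :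
    wirtinger U v * mulOp U f = mulOp U f * wirtinger U v + mulOp U (wirtinger U v f) := by
  refine LinearMap.ext fun g => ?_
  show wirtinger U v (f * g) = f * wirtinger U v g + wirtinger U v f * g
  rw [wirtinger_mul, mul_comm g]

theorem mulOp_one (U : Dom) : mulOp U 1 = 1 := LinearMap.ext fun h => one_mul h

theorem mulOp_zero (U : Dom) : mulOp U 0 = 0 := LinearMap.ext fun h => zero_mul h

theorem dx_mul_x (U : Dom) : dx U * mulOp U (x U) = mulOp U (x U) * dx U + 1 := by
  rw [dx, wirtinger_mulOp, wirtinger_x, map_one, mulOp_one]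

theorem dy_mul_y (U : Dom) : dy U * mulOp U (y U) = mulOp U (y U) * dy U + 1 := by
  rw [dy, wirtinger_mulOp, wirtinger_y, map_one, mulOp_one]

theorem commute_dx_y (U : Dom) : Commute (dx U) (mulOp U (y U)) := by
  rw [Commute, SemiconjBy, dx, wirtinger_mulOp, wirtinger_y, map_zero, mulOp_zero, add_zero]

theorem commute_dy_x (U : Dom) : Commute (dy U) (mulOp U (x U)) := by
  rw [Commute, SemiconjBy, dy, wirtinger_mulOp, wirtinger_x, map_zero, mulOp_zero, add_zero]

theorem commute_dx_dy (U : Dom) : Commute (dx U) (dy U) := wirtinger_comm U _ _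

/-- The value of a differential operator on `P(x) Q(y)` in terms of Taylor coefficients. -/
theorem diffOp_polyProd (U : Dom) (f : ℕ × ℕ →₀ Smooth U) (P Q : Polynomial ℂ) (p : U) :
    ((f.sum fun i g => mulOp U g * dx U ^ i.1 * dy U ^ i.2) (polyProd U P Q)).1 p =
      f.sum fun i g => g.1 p * ((i.1.factorial : ℂ) * (Polynomial.taylor p.1.1 P).coeff i.1) *
        ((i.2.factorial : ℂ) * (Polynomial.taylor p.1.2 Q).coeff i.2) := by
  simp only [Finsupp.sum, LinearMap.sum_apply, AddSubmonoidClass.coe_finsetSum, Finset.sum_apply]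
  refine Finset.sum_congr rfl fun i _ => ?_
  rw [Module.End.mul_apply, Module.End.mul_apply, dy_pow_polyProd, dx_pow_polyProd, mulOp_apply,
    Subalgebra.coe_mul, Pi.mul_apply, polyProd_val, eval_iterate_derivative,
    eval_iterate_derivative]
  ring

/-! ### Leading terms in an abstract Weyl algebra. -/

section Weyl

variable {A : Type*} [Ring A] [Algebra ℂ A]

/-- The span of the `X^u D^i` with `i < a`. -/
def ordLT (X D : A) (a : ℕ) : Submodule ℂ A :=
  Submodule.span ℂ {P | ∃ u i : ℕ, i < a ∧ P = X ^ u * D ^ i}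

/-- `P = X^u D^a` up to terms of order less than `a`. -/
def HasLead (X D P : A) (u a : ℕ) : Prop := P - X ^ u * D ^ a ∈ ordLT X D a

variable {X D : A}

theorem mem_ordLT {u i a : ℕ} (h : i < a) : X ^ u * D ^ i ∈ ordLT X D a :=
  Submodule.subset_span ⟨u, i, h, rfl⟩

theorem ordLT_mono {a b : ℕ} (h : a ≤ b) : ordLT X D a ≤ ordLT X D b :=
  Submodule.span_mono fun _ ⟨u, i, hi, hP⟩ => ⟨u, i, hi.trans_le h, hP⟩

theorem mul_mem_ordLT_of_forall {a b : ℕ} {B P : A}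
    (h : ∀ u i, i < a → B * (X ^ u * D ^ i) ∈ ordLT X D b)
    (hP : P ∈ ordLT X D a) : B * P ∈ ordLT X D b := by
  induction hP using Submodule.span_induction with
  | mem P hP => obtain ⟨u, i, hi, rfl⟩ := hP; exact h u i hi
  | zero => rw [mul_zero]; exact zero_mem _
  | add P Q _ _ hP hQ => rw [mul_add]; exact add_mem hP hQ
  | smul c P _ hP => rw [mul_smul_comm]; exact Submodule.smul_mem _ c hP

theorem ordLT_mul_mem_of_forall {a b : ℕ} {B P : A}
    (h : ∀ u i, i < a → X ^ u * D ^ i * B ∈ ordLT X D b)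
    (hP : P ∈ ordLT X D a) : P * B ∈ ordLT X D b := by
  induction hP using Submodule.span_induction with
  | mem P hP => obtain ⟨u, i, hi, rfl⟩ := hP; exact h u i hi
  | zero => rw [zero_mul]; exact zero_mem _
  | add P Q _ _ hP hQ => rw [add_mul]; exact add_mem hP hQ
  | smul c P _ hP => rw [smul_mul_assoc]; exact Submodule.smul_mem _ c hP

theorem pow_mul_mem_ordLT {a : ℕ} {P : A} (v : ℕ) (hP : P ∈ ordLT X D a) :
    X ^ v * P ∈ ordLT X D a :=
  mul_mem_ordLT_of_forall (fun u i hi => by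
    rw [← mul_assoc, ← pow_add]; exact mem_ordLT hi) hP

theorem mem_ordLT_mul_pow {a : ℕ} {P : A} (b : ℕ) (hP : P ∈ ordLT X D a) :
    P * D ^ b ∈ ordLT X D (a + b) :=
  ordLT_mul_mem_of_forall (fun u i hi => by
    rw [mul_assoc, ← pow_add]; exact mem_ordLT (by omega)) hP

theorem deriv_mul_pow (h : D * X = X * D + 1) (u : ℕ) :
    D * X ^ u = X ^ u * D + (u : ℂ) • X ^ (u - 1) := by
  induction u with
  | zero => simp
  | succ u ih =>
    rw [pow_succ, ← mul_assoc, ih, add_mul, mul_assoc, h, mul_add, mul_one, smul_mul_assoc,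
      add_tsub_cancel_right, ← mul_assoc]
    rcases u with _ | u
    · simp
    · rw [add_tsub_cancel_right, Nat.cast_succ (u + 1), add_smul, one_smul, pow_succ X u]
      abel

theorem deriv_mul_mem_ordLT (h : D * X = X * D + 1) {a : ℕ} {P : A} (hP : P ∈ ordLT X D a) :
    D * P ∈ ordLT X D (a + 1) :=
  mul_mem_ordLT_of_forall (fun u i hi => by
    rw [← mul_assoc, deriv_mul_pow h, add_mul, mul_assoc, ← pow_succ', smul_mul_assoc]
    exact add_mem (mem_ordLT (by omega)) (Submodule.smul_mem _ _ (mem_ordLT (by omega)))) hP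

theorem deriv_pow_mul_pow (h : D * X = X * D + 1) (a v : ℕ) :
    D ^ a * X ^ v - X ^ v * D ^ a ∈ ordLT X D a := by
  induction a with
  | zero => simp
  | succ a ih =>
    have e : D ^ (a + 1) * X ^ v - X ^ v * D ^ (a + 1) =
        D * (D ^ a * X ^ v - X ^ v * D ^ a) + (v : ℂ) • (X ^ (v - 1) * D ^ a) := by
      have e1 : (v : ℂ) • (X ^ (v - 1) * D ^ a) = (D * X ^ v - X ^ v * D) * D ^ a := by
        rw [deriv_mul_pow h, add_sub_cancel_left, smul_mul_assoc]
      rw [e1, pow_succ']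
      noncomm_ring
    rw [e]
    exact add_mem (deriv_mul_mem_ordLT h ih) (Submodule.smul_mem _ _ (mem_ordLT (by omega)))

/-- Orders add, since moving `D^i` past `X^v` costs only terms of order below `i`. The bound `b + 1`
on `Q` means order at most `b`, so one strict inequality is kept. -/
theorem mul_mem_ordLT (h : D * X = X * D + 1) {a b : ℕ} {P Q : A} (hP : P ∈ ordLT X D a)
    (hQ : Q ∈ ordLT X D (b + 1)) : P * Q ∈ ordLT X D (a + b) := by
  refine ordLT_mul_mem_of_forall (fun u i hi => ?_) hP
  refine mul_mem_ordLT_of_forall (fun v j hj => ?_) hQ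
  have e : X ^ u * D ^ i * (X ^ v * D ^ j) =
      X ^ u * ((D ^ i * X ^ v - X ^ v * D ^ i) * D ^ j) + X ^ (u + v) * D ^ (i + j) := by
    rw [pow_add, pow_add]; noncomm_ring
  rw [e]
  exact add_mem (ordLT_mono (by omega) (pow_mul_mem_ordLT u (mem_ordLT_mul_pow j
    (deriv_pow_mul_pow h i v)))) (mem_ordLT (by omega))

theorem HasLead.mem {P : A} {u a : ℕ} (h : HasLead X D P u a) : P ∈ ordLT X D (a + 1) := by
  rw [← sub_add_cancel P (X ^ u * D ^ a)]
  exact add_mem (ordLT_mono a.le_succ h) (mem_ordLT a.lt_succ_self)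

/-- Symbols multiply: the associated graded algebra of the order filtration is commutative. Only the
order of the error is controlled, not its degree in `X`. -/
theorem HasLead.mul (h : D * X = X * D + 1) {P Q : A} {u a v b : ℕ} (hP : HasLead X D P u a)
    (hQ : HasLead X D Q v b) : HasLead X D (P * Q) (u + v) (a + b) := by
  have e : P * Q - X ^ (u + v) * D ^ (a + b) = (P - X ^ u * D ^ a) * Q +
      (X ^ u * (D ^ a * (Q - X ^ v * D ^ b)) +
        X ^ u * ((D ^ a * X ^ v - X ^ v * D ^ a) * D ^ b)) := by
    rw [pow_add, pow_add]; noncomm_ring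
  rw [HasLead, e]
  refine add_mem (mul_mem_ordLT h hP hQ.mem) (add_mem (pow_mul_mem_ordLT u ?_)
    (pow_mul_mem_ordLT u (mem_ordLT_mul_pow b (deriv_pow_mul_pow h a v))))
  -- What remains is that `D^a` raises the order of the error of `Q` by at most `a`, by induction on
  -- `a`.
  clear e hP P
  induction a with
  | zero => simpa [HasLead] using hQ
  | succ a ih =>
    rw [pow_succ', mul_assoc]
    exact ordLT_mono (by omega) (deriv_mul_mem_ordLT h ih)

theorem HasLead.one : HasLead X D (1 : A) 0 0 := by simp [HasLead]

theorem HasLead.pow (h : D * X = X * D + 1) {P : A} {u a : ℕ} (hP : HasLead X D P u a) (n : ℕ) :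
    HasLead X D (P ^ n) (n * u) (n * a) := by
  induction n with
  | zero => simpa using HasLead.one
  | succ n ih => rw [pow_succ, Nat.succ_mul, Nat.succ_mul]; exact ih.mul h hP

theorem hasLead_pow_left (u : ℕ) : HasLead X D (X ^ u) u 0 := by simp [HasLead]

theorem hasLead_pow_right (a : ℕ) : HasLead X D (D ^ a) 0 a := by simp [HasLead]

theorem hasLead_euler (c : ℂ) : HasLead X D (X * D - algebraMap ℂ A c) 1 1 := by
  have e : X * D - algebraMap ℂ A c - X ^ 1 * D ^ 1 = (-c) • (X ^ 0 * D ^ 0) := by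
    rw [pow_one, pow_one, pow_zero, pow_zero, mul_one, neg_smul, Algebra.algebraMap_eq_smul_one]
    abel
  rw [HasLead, e]
  exact Submodule.smul_mem _ _ (mem_ordLT one_pos)

theorem hasLead_slZero (c : ℂ) : HasLead X D (slZero X D c) 1 1 := hasLead_euler _

theorem hasLead_slPM_plus (c : ℂ) : HasLead X D (slPM X D c .plus) 2 1 := by
  have e : slPM X D c .plus - X ^ 2 * D ^ 1 = (-c) • (X ^ 1 * D ^ 0) := by
    rw [slPM, pow_one, pow_one, pow_zero, mul_one, neg_smul]
    abel
  rw [HasLead, e]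
  exact Submodule.smul_mem _ _ (mem_ordLT one_pos)

theorem hasLead_slPM_minus (c : ℂ) : HasLead X D (slPM X D c .minus) 0 1 := by
  simp [HasLead, slPM]

theorem HasLead.list_prod (h : D * X = X * D + 1) (l : List A)
    (hl : ∀ P ∈ l, HasLead X D P 1 1) : HasLead X D l.prod l.length l.length := by
  induction l with
  | nil => exact HasLead.one
  | cons P l ih =>
    rw [List.prod_cons, List.length_cons, add_comm]
    exact (hl P List.mem_cons_self).mul h (ih fun Q hQ => hl Q (List.mem_cons_of_mem _ hQ))

/-- Fixes the index of the product as a natural number, which the length count and the induction on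
the number of factors rely on. -/
theorem qbar_eq (n Δ α : ℕ) : qbar X D n Δ α = ((List.range (Δ - α)).map fun k : ℕ =>
    X * D - algebraMap ℂ A ((n : ℂ) - Δ + ((k : ℂ) + 1))).prod * D ^ α := by
  simp [qbar, Function.comp_def, ← List.map_eq_flatMap]

theorem hasLead_qbar (h : D * X = X * D + 1) (n : ℕ) {Δ α : ℕ} (hα : α ≤ Δ) :
    HasLead X D (qbar X D n Δ α) (Δ - α) Δ := by
  have h1 := HasLead.list_prod h ((List.range (Δ - α)).map fun k : ℕ =>
    X * D - algebraMap ℂ A ((n : ℂ) - Δ + ((k : ℂ) + 1))) (fun P hP => by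
      obtain ⟨k, _, rfl⟩ := List.mem_map.1 hP; exact hasLead_euler _)
  have h2 := h1.mul h (hasLead_pow_right α)
  rw [List.length_map, List.length_range, add_zero, Nat.sub_add_cancel hα] at h2
  rw [qbar_eq]
  exact h2

end Weyl

/-! ### One-variable operators acting on a ladder of monomials. -/

section Ladder

variable {V : Type*} [AddCommGroup V] [Module ℂ V]

/-- `P` maps `e 0, …, e N` into the span of `e 0, …, e N'`. -/
def MapsLadder (e : ℕ → V) (P : Module.End ℂ V) (N N' : ℕ) : Prop :=
  ∀ p ≤ N, P (e p) ∈ Submodule.span ℂ (e '' Set.Iic N')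

variable {e : ℕ → V} {X D : Module.End ℂ V}

theorem MapsLadder.map_mem {P : Module.End ℂ V} {N N' : ℕ} (h : MapsLadder e P N N') {v : V}
    (hv : v ∈ Submodule.span ℂ (e '' Set.Iic N)) : P v ∈ Submodule.span ℂ (e '' Set.Iic N') := by
  induction hv using Submodule.span_induction with
  | mem v hv => obtain ⟨p, hp, rfl⟩ := hv; exact h p hp
  | zero => rw [map_zero]; exact zero_mem _
  | add v w _ _ hv hw => rw [map_add]; exact add_mem hv hw
  | smul c v _ hv => rw [map_smul]; exact Submodule.smul_mem _ c hv

theorem MapsLadder.mul {P Q : Module.End ℂ V} {N N' N'' : ℕ} (hP : MapsLadder e P N' N'')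
    (hQ : MapsLadder e Q N N') : MapsLadder e (P * Q) N N'' :=
  fun p hp => hP.map_mem (hQ p hp)

theorem MapsLadder.one (N : ℕ) : MapsLadder e 1 N N :=
  fun p hp => Submodule.subset_span ⟨p, hp, rfl⟩

theorem MapsLadder.pow {P : Module.End ℂ V} {N : ℕ} (hP : MapsLadder e P N N) (i : ℕ) :
    MapsLadder e (P ^ i) N N := by
  induction i with
  | zero => exact .one N
  | succ i ih => rw [pow_succ]; exact ih.mul hP

-- The model is `e p = x^p y^j` with `j` fixed, or the same with `x` and `y` exchanged. The
-- truncated `p - 1` at `p = 0` is harmless because its coefficient is `0`.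
variable (hX : ∀ p, X (e p) = e (p + 1)) (hD : ∀ p, D (e p) = (p : ℂ) • e (p - 1))

include hX in
theorem mapsLadder_pow_left (N u : ℕ) : MapsLadder e (X ^ u) N (N + u) := by
  induction u with
  | zero => exact .one N
  | succ u ih =>
    rw [pow_succ']
    exact MapsLadder.mul (fun p hp => hX p ▸ Submodule.subset_span ⟨p + 1, Nat.succ_le_succ hp, rfl⟩)
      ih

include hD in
theorem mapsLadder_deriv (N : ℕ) : MapsLadder e D N (N - 1) := fun p hp => by
  rw [hD]
  exact Submodule.smul_mem _ _ (Submodule.subset_span ⟨p - 1, Nat.sub_le_sub_right hp 1, rfl⟩)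

include hD in
theorem mapsLadder_deriv_pow (N a : ℕ) : MapsLadder e (D ^ a) N (N - a) := by
  induction a with
  | zero => exact .one N
  | succ a ih => rw [pow_succ']; exact (mapsLadder_deriv hD (N - a)).mul ih

include hX hD in
theorem euler_ladder (p : ℕ) : (X * D) (e p) = (p : ℂ) • e p := by
  rw [Module.End.mul_apply, hD, map_smul, hX]
  rcases p with _ | p
  · simp
  · rfl

include hX hD in
theorem euler_sub_ladder (c : ℂ) (p : ℕ) :
    (X * D - algebraMap ℂ (Module.End ℂ V) c) (e p) = ((p : ℂ) - c) • e p := by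
  rw [LinearMap.sub_apply, euler_ladder hX hD, Module.algebraMap_end_apply, sub_smul]

include hX hD in
theorem mapsLadder_slZero (c : ℂ) (N : ℕ) : MapsLadder e (slZero X D c) N N := fun p hp => by
  rw [slZero, euler_sub_ladder hX hD]
  exact Submodule.smul_mem _ _ (Submodule.subset_span ⟨p, hp, rfl⟩)

include hX hD in
theorem mapsLadder_slPM (N : ℕ) (ε : Sgn) : MapsLadder e (slPM X D (N : ℂ) ε) N N := by
  cases ε with
  | minus =>
    intro p hp
    exact Submodule.span_mono (Set.image_mono (Set.Iic_subset_Iic.2 (Nat.sub_le N 1)))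
      (mapsLadder_deriv hD N p hp)
  | plus =>
    intro p hp
    have h : slPM X D (N : ℂ) .plus (e p) = ((p : ℂ) - N) • e (p + 1) := by
      rw [slPM, LinearMap.sub_apply, LinearMap.smul_apply, hX, pow_two, mul_assoc,
        Module.End.mul_apply, euler_ladder hX hD, map_smul, hX, sub_smul]
    rw [h]
    -- The parameter `N` of `J^+` is exactly what kills the top vector `e N`.
    rcases hp.eq_or_lt with rfl | hp
    · rw [sub_self, zero_smul]; exact zero_mem _
    · exact Submodule.smul_mem _ _ (Submodule.subset_span ⟨p + 1, hp, rfl⟩)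

include hX hD in
-- The Euler operator is diagonal, and the shift `N + 1` is its eigenvalue on the single vector `e
-- (N + 1)` to be removed.
theorem mapsLadder_euler_sub (N : ℕ) :
    MapsLadder e (X * D - algebraMap ℂ (Module.End ℂ V) ((N : ℂ) + 1)) (N + 1) N := fun p hp => by
  rw [euler_sub_ladder hX hD]
  rcases hp.eq_or_lt with rfl | hp
  · rw [Nat.cast_succ, sub_self, zero_smul]; exact zero_mem _
  · exact Submodule.smul_mem _ _ (Submodule.subset_span ⟨p, Nat.lt_succ_iff.1 hp, rfl⟩)

include hX hD in
theorem mapsLadder_qbar {n Δ α : ℕ} (hΔ : Δ ≤ n) (hα : α ≤ Δ) :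
    MapsLadder e (qbar X D n Δ α) n (n - Δ) := by
  rw [qbar_eq]
  -- The factor with index `k` removes the vector of degree `n - Δ + k + 1`. The rightmost factor
  -- acts first and has the largest index, so the ladder shortens from the top by one each time;
  -- `D^α` has already brought `n` down to `n - Δ + (Δ - α)`.
  have key : ∀ r : ℕ, MapsLadder e ((List.range r).map fun k : ℕ =>
      X * D - algebraMap ℂ (Module.End ℂ V) ((n : ℂ) - Δ + ((k : ℂ) + 1))).prod
      (n - Δ + r) (n - Δ) := by
    intro r
    induction r with
    | zero => exact .one _
    | succ r ih =>
      rw [List.range_succ, List.map_append, List.prod_append, List.map_singleton,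
        List.prod_singleton]
      have h := mapsLadder_euler_sub hX hD (n - Δ + r)
      rw [Nat.cast_add, Nat.cast_sub hΔ, add_assoc] at h
      exact ih.mul h
  refine (key _).mul ?_
  have h := mapsLadder_deriv_pow hD n α
  rwa [show n - α = n - Δ + (Δ - α) by omega] at h

end Ladder

/-! ### Rectangular modules as spaces of polynomials. -/

theorem monomial_mem_rect {U : Dom} {i j a b : ℕ} (hi : i ≤ a) (hj : j ≤ b) :
    x U ^ i * y U ^ j ∈ rect U a b := Submodule.subset_span ⟨i, j, hi, hj, rfl⟩

theorem monomial_mul_mem_rect {U : Dom} {a b : ℕ} {f : Smooth U} (u v : ℕ) (hf : f ∈ rect U a b) :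
    x U ^ u * y U ^ v * f ∈ rect U (a + u) (b + v) := by
  induction hf using Submodule.span_induction with
  | mem f hf =>
    obtain ⟨i, j, hi, hj, rfl⟩ := hf
    rw [mul_mul_mul_comm, ← pow_add, ← pow_add]
    exact monomial_mem_rect (by omega) (by omega)
  | zero => rw [mul_zero]; exact zero_mem _
  | add f g _ _ hf hg => rw [mul_add]; exact add_mem hf hg
  | smul c f _ hf => rw [mul_smul_comm]; exact Submodule.smul_mem _ c hf

theorem rect_mono {U : Dom} {a b a' b' : ℕ} (ha : a ≤ a') (hb : b ≤ b') :
    rect U a b ≤ rect U a' b' :=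
  Submodule.span_mono fun _ ⟨i, j, hi, hj, h⟩ => ⟨i, j, hi.trans ha, hj.trans hb, h⟩

theorem polyProd_mem_rect {U : Dom} {P Q : Polynomial ℂ} {a b : ℕ} (hP : P.natDegree ≤ a)
    (hQ : Q.natDegree ≤ b) : polyProd U P Q ∈ rect U a b := by
  rw [polyProd, Polynomial.aeval_eq_sum_range' (Nat.lt_succ_of_le hP),
    Polynomial.aeval_eq_sum_range' (Nat.lt_succ_of_le hQ), Finset.sum_mul_sum]
  refine sum_mem fun i hi => sum_mem fun j hj => ?_
  rw [smul_mul_smul_comm]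
  exact Submodule.smul_mem _ _ (monomial_mem_rect (Finset.mem_range_succ_iff.1 hi)
    (Finset.mem_range_succ_iff.1 hj))

theorem polyProd_X_pow (U : Dom) (i j : ℕ) :
    polyProd U (Polynomial.X ^ i) (Polynomial.X ^ j) = x U ^ i * y U ^ j := by
  simp [polyProd]

theorem dx_monomial (U : Dom) (i j : ℕ) :
    dx U (x U ^ i * y U ^ j) = (i : ℂ) • (x U ^ (i - 1) * y U ^ j) := by
  rw [← polyProd_X_pow, dx_polyProd, Polynomial.derivative_X_pow]
  simp [polyProd, Algebra.smul_def, mul_assoc]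

theorem dy_monomial (U : Dom) (i j : ℕ) :
    dy U (x U ^ i * y U ^ j) = (j : ℂ) • (x U ^ i * y U ^ (j - 1)) := by
  rw [← polyProd_X_pow, dy_polyProd, Polynomial.derivative_X_pow]
  simp [polyProd, Algebra.smul_def, mul_left_comm]

/-- `P` maps `R_{N,B}` to `R_{N',B}` for every `B`. -/
def MapsX (U : Dom) (P : Op U) (N N' : ℕ) : Prop := ∀ B, ∀ f ∈ rect U N B, P f ∈ rect U N' B

/-- `P` maps `R_{A,M}` to `R_{A,M'}` for every `A`. -/
def MapsY (U : Dom) (P : Op U) (M M' : ℕ) : Prop := ∀ A, ∀ f ∈ rect U A M, P f ∈ rect U A M'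

theorem mapsX_of_ladder {U : Dom} {P : Op U} {N N' : ℕ}
    (h : ∀ j, MapsLadder (fun i => x U ^ i * y U ^ j) P N N') : MapsX U P N N' := by
  intro B f hf
  induction hf using Submodule.span_induction with
  | mem f hf =>
    obtain ⟨i, j, hi, hj, rfl⟩ := hf
    refine Submodule.span_le.2 ?_ (h j i hi)
    rintro _ ⟨p, hp, rfl⟩
    exact monomial_mem_rect hp hj
  | zero => rw [map_zero]; exact zero_mem _
  | add v w _ _ hv hw => rw [map_add]; exact add_mem hv hw
  | smul c v _ hv => rw [map_smul]; exact Submodule.smul_mem _ c hv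

theorem mapsY_of_ladder {U : Dom} {P : Op U} {N N' : ℕ}
    (h : ∀ i, MapsLadder (fun j => x U ^ i * y U ^ j) P N N') : MapsY U P N N' := by
  intro B f hf
  induction hf using Submodule.span_induction with
  | mem f hf =>
    obtain ⟨i, j, hi, hj, rfl⟩ := hf
    refine Submodule.span_le.2 ?_ (h i j hj)
    rintro _ ⟨p, hp, rfl⟩
    exact monomial_mem_rect hi hp
  | zero => rw [map_zero]; exact zero_mem _
  | add v w _ _ hv hw => rw [map_add]; exact add_mem hv hw
  | smul c v _ hv => rw [map_smul]; exact Submodule.smul_mem _ c hv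

theorem mulOp_x_monomial (U : Dom) (i j : ℕ) :
    mulOp U (x U) (x U ^ i * y U ^ j) = x U ^ (i + 1) * y U ^ j := by
  rw [mulOp_apply, ← mul_assoc, pow_succ']

theorem mulOp_y_monomial (U : Dom) (i j : ℕ) :
    mulOp U (y U) (x U ^ i * y U ^ j) = x U ^ i * y U ^ (j + 1) := by
  rw [mulOp_apply, mul_left_comm, pow_succ']

/-- The evaluation of a polynomial at the coordinate functions. -/
def mvEval (U : Dom) : MvPolynomial (Fin 2) ℂ →ₐ[ℂ] Smooth U := MvPolynomial.aeval ![x U, y U]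

theorem mvEval_val (U : Dom) (F : MvPolynomial (Fin 2) ℂ) (p : U) :
    (mvEval U F).1 p = MvPolynomial.eval ![p.1.1, p.1.2] F := by
  induction F using MvPolynomial.induction_on with
  | C c => simp only [mvEval, MvPolynomial.aeval_C, MvPolynomial.eval_C]; rfl
  | add F G hF hG => simp only [map_add, Subalgebra.coe_add, Pi.add_apply, hF, hG]
  | mul_X F i hF =>
    simp only [map_mul, Subalgebra.coe_mul, Pi.mul_apply, hF, MvPolynomial.eval_X]
    congr 1
    fin_cases i <;> simp [mvEval] <;> rfl

/-- A neighbourhood of `p` contains a product of two infinite sets, and a polynomial is determined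
by its values there. Connectedness of `U` plays no role. -/
theorem mvEval_injective {U : Dom} (p : U) : Function.Injective (mvEval U) := by
  intro F G h
  obtain ⟨s, hs, t, ht, hst⟩ := mem_nhds_prod_iff.1 (U.isOpen.mem_nhds p.2)
  refine MvPolynomial.funext_set (fun i : Fin 2 => (![s, t] i : Set ℂ)) ?_ fun z hz => ?_
  · intro i
    fin_cases i
    · exact infinite_of_mem_nhds _ hs
    · exact infinite_of_mem_nhds _ ht
  · have hz' : (z 0, z 1) ∈ U := hst ⟨hz 0 trivial, hz 1 trivial⟩
    have e := congrArg (fun f : Smooth U => f.1 ⟨_, hz'⟩) h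
    simp only [mvEval_val] at e
    have hz2 : ![z 0, z 1] = z := by ext i; fin_cases i <;> rfl
    rwa [hz2] at e

theorem exists_mvEval {U : Dom} {a b : ℕ} {f : Smooth U} (hf : f ∈ rect U a b) :
    ∃ F, mvEval U F = f ∧ ∀ m, F.coeff m ≠ 0 → m 0 ≤ a ∧ m 1 ≤ b := by
  induction hf using Submodule.span_induction with
  | mem f hf =>
    obtain ⟨i, j, hi, hj, rfl⟩ := hf
    refine ⟨MvPolynomial.monomial (Finsupp.single 0 i + Finsupp.single 1 j) 1, ?_, fun m hm => ?_⟩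
    · rw [mvEval, MvPolynomial.aeval_monomial, map_one, one_mul,
        Finsupp.prod_fintype _ _ (fun _ => pow_zero _), Fin.prod_univ_two]
      simp
    · rw [MvPolynomial.coeff_monomial] at hm
      obtain rfl := (ite_ne_right_iff.1 hm).1
      simp [hi, hj]
  | zero => exact ⟨0, map_zero _, fun m hm => absurd (MvPolynomial.coeff_zero m) hm⟩
  | add f g _ _ hf hg =>
    obtain ⟨F, rfl, hF⟩ := hf
    obtain ⟨G, rfl, hG⟩ := hg
    refine ⟨F + G, map_add _ _ _, fun m hm => ?_⟩
    by_cases h : F.coeff m = 0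
    · exact hG m fun h' => hm (by rw [MvPolynomial.coeff_add, h, h', add_zero])
    · exact hF m h
  | smul c f _ hf =>
    obtain ⟨F, rfl, hF⟩ := hf
    refine ⟨c • F, map_smul _ _ _, fun m hm => hF m fun h => hm ?_⟩
    rw [MvPolynomial.coeff_smul, h, smul_zero]

/-- Multiplication by `x^r y^s` shifts every exponent, and the coefficients of a polynomial function
on a nonempty open set are unique. For empty `U` all functions are zero. -/
theorem mem_span_of_monomial_mul_mem {U : Dom} {a b r s : ℕ} {f : Smooth U} (hf : f ∈ rect U a b)
    (hrs : x U ^ r * y U ^ s * f ∈ rect U a b) :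
    f ∈ Submodule.span ℂ {g | ∃ u v : ℕ, u + r ≤ a ∧ v + s ≤ b ∧ g = x U ^ u * y U ^ v} := by
  rcases isEmpty_or_nonempty U with hU | ⟨⟨p⟩⟩
  · rw [show f = 0 from Subtype.ext (funext fun p => hU.elim p)]
    exact zero_mem _
  obtain ⟨F, rfl, -⟩ := exists_mvEval hf
  obtain ⟨G, hG, hGm⟩ := exists_mvEval hrs
  have e : G = MvPolynomial.monomial (Finsupp.single 0 r + Finsupp.single 1 s) 1 * F := by
    refine mvEval_injective p ?_
    rw [hG, map_mul]
    congr 1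
    rw [mvEval, MvPolynomial.aeval_monomial, map_one, one_mul,
      Finsupp.prod_fintype _ _ (fun _ => pow_zero _), Fin.prod_univ_two]
    simp
  rw [F.as_sum, map_sum]
  refine sum_mem fun m hm => ?_
  rw [mvEval, MvPolynomial.aeval_monomial, Finsupp.prod_fintype _ _ (fun _ => pow_zero _),
    Fin.prod_univ_two, ← Algebra.smul_def]
  refine Submodule.smul_mem _ _ (Submodule.subset_span ⟨m 0, m 1, ?_, ?_, by simp⟩)
  all_goals
    have h := hGm (Finsupp.single 0 r + Finsupp.single 1 s + m) (by
      rw [e, MvPolynomial.coeff_monomial_mul, one_mul]; exact MvPolynomial.mem_support_iff.1 hm)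
    simp at h
    omega

theorem exists_slice_x {U : Dom} {a b : ℕ} {f : Smooth U} (hf : f ∈ rect U a b) (c : ℂ) :
    ∃ F : Polynomial ℂ, F.natDegree ≤ a ∧ ∀ p : U, p.1.2 = c → f.1 p = F.eval p.1.1 := by
  induction hf using Submodule.span_induction with
  | mem f hf =>
    obtain ⟨i, j, hi, hj, rfl⟩ := hf
    refine ⟨Polynomial.C (c ^ j) * Polynomial.X ^ i,
      (Polynomial.natDegree_C_mul_X_pow_le _ _).trans hi, fun p hp => ?_⟩
    rw [← polyProd_X_pow, polyProd_val, hp]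
    simp [mul_comm]
  | zero => exact ⟨0, by simp, fun p _ => by simp⟩
  | add f g _ _ hf hg =>
    obtain ⟨F, hF, hF'⟩ := hf
    obtain ⟨G, hG, hG'⟩ := hg
    refine ⟨F + G, Polynomial.natDegree_add_le_of_degree_le hF hG, fun p hp => ?_⟩
    rw [Polynomial.eval_add, ← hF' p hp, ← hG' p hp]; rfl
  | smul d f _ hf =>
    obtain ⟨F, hF, hF'⟩ := hf
    refine ⟨d • F, (Polynomial.natDegree_smul_le _ _).trans hF, fun p hp => ?_⟩
    rw [Polynomial.eval_smul, ← hF' p hp]; rfl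

theorem exists_slice_y {U : Dom} {a b : ℕ} {f : Smooth U} (hf : f ∈ rect U a b) (c : ℂ) :
    ∃ F : Polynomial ℂ, F.natDegree ≤ b ∧ ∀ p : U, p.1.1 = c → f.1 p = F.eval p.1.2 := by
  induction hf using Submodule.span_induction with
  | mem f hf =>
    obtain ⟨i, j, hi, hj, rfl⟩ := hf
    refine ⟨Polynomial.C (c ^ i) * Polynomial.X ^ j,
      (Polynomial.natDegree_C_mul_X_pow_le _ _).trans hj, fun p hp => ?_⟩
    rw [← polyProd_X_pow, polyProd_val, hp]
    simp
  | zero => exact ⟨0, by simp, fun p _ => by simp⟩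
  | add f g _ _ hf hg =>
    obtain ⟨F, hF, hF'⟩ := hf
    obtain ⟨G, hG, hG'⟩ := hg
    refine ⟨F + G, Polynomial.natDegree_add_le_of_degree_le hF hG, fun p hp => ?_⟩
    rw [Polynomial.eval_add, ← hF' p hp, ← hG' p hp]; rfl
  | smul d f _ hf =>
    obtain ⟨F, hF, hF'⟩ := hf
    refine ⟨d • F, (Polynomial.natDegree_smul_le _ _).trans hF, fun p hp => ?_⟩
    rw [Polynomial.eval_smul, ← hF' p hp]; rfl

/-- Agreement on an infinite set is equality of polynomials; a polynomial of degree below `n`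
divisible by `(X - z)^n` is zero, hence so is the cofactor. -/
theorem eq_zero_of_pow_mul_eval {s : Set ℂ} (hs : s.Infinite) {z : ℂ} {n : ℕ}
    {G H : Polynomial ℂ} (hG : G.natDegree < n)
    (h : ∀ w ∈ s, G.eval w = (w - z) ^ n * H.eval w) : H = 0 := by
  have e : G = (Polynomial.X - Polynomial.C z) ^ n * H :=
    Polynomial.eq_of_infinite_eval_eq _ _ (hs.mono fun w hw => by simp [h w hw])
  by_contra hH
  rw [e, (Polynomial.monic_X_sub_C z).pow n |>.natDegree_mul' hH, Polynomial.natDegree_pow,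
    Polynomial.natDegree_X_sub_C] at hG
  omega

/-! ### Coefficients recovered from the action on polynomials. -/

/-- The differential operator with coefficients `f`. -/
def diffOp (U : Dom) (f : ℕ × ℕ →₀ Smooth U) : Op U :=
  f.sum fun p g => mulOp U g * dx U ^ p.1 * dy U ^ p.2

theorem polyProd_mul_sub_pow (U : Dom) (a b r s : ℕ) (z w : ℂ) :
    polyProd U (Polynomial.X ^ r * (Polynomial.X - Polynomial.C z) ^ a)
        (Polynomial.X ^ s * (Polynomial.X - Polynomial.C w) ^ b) =
      ∑ i ∈ Finset.range (a + 1), ∑ j ∈ Finset.range (b + 1),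
        (((-z) ^ (a - i) * (a.choose i : ℂ)) * ((-w) ^ (b - j) * (b.choose j : ℂ))) •
          (x U ^ (r + i) * y U ^ (s + j)) := by
  have h : ∀ (a r : ℕ) (z : ℂ) (f : Smooth U),
      Polynomial.aeval f (Polynomial.X ^ r * (Polynomial.X - Polynomial.C z) ^ a) =
        ∑ i ∈ Finset.range (a + 1), ((-z) ^ (a - i) * (a.choose i : ℂ)) • f ^ (r + i) := by
    intro a r z f
    rw [sub_eq_add_neg, add_pow, Finset.mul_sum, map_sum]
    refine Finset.sum_congr rfl fun i _ => ?_
    simp only [map_mul, map_pow, map_neg, Polynomial.aeval_X, Polynomial.aeval_C, map_natCast,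
      Algebra.smul_def, pow_add]
    ring
  rw [polyProd, h, h, Finset.sum_mul_sum]
  simp only [smul_mul_smul_comm]

/-- At `z` the polynomial vanishes to order `a` with leading value `z^r`. Coefficients beyond `a`
are unconstrained unless `r = 0`, whence the hypothesis. -/
theorem coeff_taylor_X_pow_mul (a r i : ℕ) (z : ℂ) (hi : i < a ∨ i = a ∨ r = 0) :
    (Polynomial.taylor z (Polynomial.X ^ r * (Polynomial.X - Polynomial.C z) ^ a)).coeff i =
      if i = a then z ^ r else 0 := by
  rw [Polynomial.taylor_mul, Polynomial.taylor_pow, Polynomial.taylor_pow, map_sub,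
    Polynomial.taylor_X, Polynomial.taylor_C, add_sub_cancel_right, Polynomial.coeff_mul_X_pow']
  rcases hi with hi | rfl | rfl
  · rw [if_neg (by omega), if_neg (by omega)]
  · simp [Polynomial.coeff_zero_eq_eval_zero]
  · by_cases h : i = a
    · simp [h]
    · rw [if_neg h, pow_zero, Polynomial.coeff_one]
      split_ifs <;> first | rfl | omega

/-- The coefficient at `∂_x^a ∂_y^b`, recovered from the action on a polynomial. -/
theorem diffOp_apply_sub_pow {U : Dom} {f : ℕ × ℕ →₀ Smooth U} {a b r s : ℕ}
    (hf : ∀ i ∈ f.support, (i.1 < a ∨ i.2 < b) ∨ i = (a, b) ∨ (r = 0 ∧ s = 0)) (p : U) :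
    (diffOp U f (polyProd U
      (Polynomial.X ^ r * (Polynomial.X - Polynomial.C p.1.1) ^ a)
      (Polynomial.X ^ s * (Polynomial.X - Polynomial.C p.1.2) ^ b))).1 p =
      (a.factorial : ℂ) * b.factorial * (p.1.1 ^ r * p.1.2 ^ s * (f (a, b)).1 p) := by
  rw [diffOp, diffOp_polyProd, Finsupp.sum, Finset.sum_eq_single (a, b)]
  · rw [coeff_taylor_X_pow_mul a r a _ (by simp), coeff_taylor_X_pow_mul b s b _ (by simp),
      if_pos rfl, if_pos rfl]
    ring
  · intro i hi hne
    rcases hf i hi with (h | h) | h | ⟨rfl, rfl⟩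
    · rw [coeff_taylor_X_pow_mul a r i.1 _ (Or.inl h), if_neg h.ne]
      ring
    · rw [coeff_taylor_X_pow_mul b s i.2 _ (Or.inl h), if_neg h.ne]
      ring
    · exact absurd h hne
    · rw [coeff_taylor_X_pow_mul a 0 i.1 _ (by simp), coeff_taylor_X_pow_mul b 0 i.2 _ (by simp)]
      have : ¬ (i.1 = a ∧ i.2 = b) := fun h => hne (Prod.ext h.1 h.2)
      rw [not_and_or] at this
      rcases this with h | h <;> simp [h]
  · intro h
    rw [Finsupp.notMem_support_iff.1 h]
    simp

/-- The test function `x^r (x-z)^a y^s (y-w)^b` depends on the point `(z,w)`. After binomial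
expansion the powers of `z` and `w` come out of the operator, and setting `(z,w) = (x,y)` turns them
into multiplications that raise the degrees by at most `a` and `b`. -/
theorem coeff_mem_rect {U : Dom} {f : ℕ × ℕ →₀ Smooth U} {N N' M M' a b r s : ℕ}
    (hT : ∀ g ∈ rect U N M, diffOp U f g ∈ rect U N' M') (ha : r + a ≤ N) (hb : s + b ≤ M)
    (hf : ∀ i ∈ f.support, (i.1 < a ∨ i.2 < b) ∨ i = (a, b) ∨ (r = 0 ∧ s = 0)) :
    x U ^ r * y U ^ s * f (a, b) ∈ rect U (N' + a) (M' + b) := by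
  have e : ((a.factorial : ℂ) * b.factorial) • (x U ^ r * y U ^ s * f (a, b)) =
      ∑ i ∈ Finset.range (a + 1), ∑ j ∈ Finset.range (b + 1),
        ((-1) ^ (a - i) * (a.choose i : ℂ) * ((-1) ^ (b - j) * (b.choose j : ℂ))) •
          (x U ^ (a - i) * y U ^ (b - j) * diffOp U f (x U ^ (r + i) * y U ^ (s + j))) := by
    refine Subtype.ext (funext fun p => ?_)
    have h := diffOp_apply_sub_pow hf p
    rw [polyProd_mul_sub_pow] at h
    simp only [map_sum, map_smul, AddSubmonoidClass.coe_finsetSum, Finset.sum_apply] at h ⊢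
    refine (Eq.trans ?_ h.symm).trans (Finset.sum_congr rfl fun i _ =>
      Finset.sum_congr rfl fun j _ => ?_)
    · rw [Subalgebra.coe_smul, Pi.smul_apply, smul_eq_mul]
      rfl
    · rw [Subalgebra.coe_smul, Pi.smul_apply, smul_eq_mul, Subalgebra.coe_smul, Pi.smul_apply,
        smul_eq_mul, Subalgebra.coe_mul, Pi.mul_apply, neg_pow p.1.1, neg_pow p.1.2,
        show (x U ^ (a - i) * y U ^ (b - j)).1 p = p.1.1 ^ (a - i) * p.1.2 ^ (b - j) from rfl]
      ring
  have hne : (a.factorial : ℂ) * b.factorial ≠ 0 :=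
    mul_ne_zero (Nat.cast_ne_zero.2 a.factorial_ne_zero) (Nat.cast_ne_zero.2 b.factorial_ne_zero)
  rw [← Submodule.smul_mem_iff _ hne, e]
  refine sum_mem fun i hi => sum_mem fun j hj => Submodule.smul_mem _ _ ?_
  rw [Finset.mem_range] at hi hj
  exact rect_mono (by omega) (by omega) (monomial_mul_mem_rect _ _
    (hT _ (monomial_mem_rect (by omega) (by omega))))

/-- A differential operator determines its coefficients. -/
theorem diffOp_injective (U : Dom) : Function.Injective (diffOp U) := by
  intro f g h
  refine Finsupp.ext fun i => Subtype.ext (funext fun p => ?_)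
  have e : ∀ f : ℕ × ℕ →₀ Smooth U, _ := fun f => diffOp_apply_sub_pow (f := f) (a := i.1)
    (b := i.2) (r := 0) (s := 0) (fun _ _ => Or.inr (Or.inr ⟨rfl, rfl⟩)) p
  have e1 := e f
  rw [h, e g] at e1
  have hne : (i.1.factorial : ℂ) * i.2.factorial ≠ 0 :=
    mul_ne_zero (Nat.cast_ne_zero.2 (Nat.factorial_ne_zero _))
      (Nat.cast_ne_zero.2 (Nat.factorial_ne_zero _))
  have e2 := mul_left_cancel₀ hne e1
  simpa using e2.symm

theorem coeff_taylor_sub_pow (N i : ℕ) (z w : ℂ) :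
    (Polynomial.taylor w ((Polynomial.X - Polynomial.C z) ^ N)).coeff i =
      (w - z) ^ (N - i) * (N.choose i : ℂ) := by
  rw [Polynomial.taylor_pow, map_sub, Polynomial.taylor_X, Polynomial.taylor_C, add_sub_assoc,
    ← Polynomial.C_sub, Polynomial.coeff_X_add_C_pow]

theorem infinite_slice_x {U : Dom} (p : U) : {w : ℂ | (w, p.1.2) ∈ U}.Infinite :=
  infinite_of_mem_nhds p.1.1 ((Continuous.prodMk_left p.1.2).continuousAt.preimage_mem_nhds
    (U.isOpen.mem_nhds p.2))

theorem infinite_slice_y {U : Dom} (p : U) : {w : ℂ | (p.1.1, w) ∈ U}.Infinite :=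
  infinite_of_mem_nhds p.1.2 ((Continuous.prodMk_right p.1.1).continuousAt.preimage_mem_nhds
    (U.isOpen.mem_nhds p.2))

/-- The operator is applied to `(x-z)^N (y-w)^b` and restricted to the line `y = w`. Only
derivatives with `∂_y^b` survive there, and these have `x`-order at most `a`, so the result is
divisible by `(x-z)^(N-a)`. Its degree is at most `N' < N - a`, so the cofactor is zero; its value
at `z` is a nonzero multiple of the coefficient. -/
theorem top_coeff_eq_zero_x {U : Dom} {f : ℕ × ℕ →₀ Smooth U} {N N' M M' a b : ℕ}
    (hT : ∀ g ∈ rect U N M, diffOp U f g ∈ rect U N' M') (hN : ∀ i ∈ f.support, i.1 ≤ N)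
    (hf : ∀ i ∈ f.support, i.1 + i.2 ≤ a + b) (hb : b ≤ M) (ha : N' + a < N) :
    f (a, b) = 0 := by
  refine Subtype.ext (funext fun p => ?_)
  -- All coefficients at `∂_x^i ∂_y^b`, not only the top one, must be polynomial on the line for the
  -- cofactor to be a polynomial; the bound `hN` ensures this. Other indices get the dummy value
  -- `0`.
  have hsl : ∀ i : ℕ × ℕ, ∃ F : Polynomial ℂ, i ∈ f.support → i.2 = b →
      ∀ q : U, q.1.2 = p.1.2 → (f i).1 q = F.eval q.1.1 := by
    intro i
    by_cases h : i ∈ f.support ∧ i.2 = b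
    · have hm := coeff_mem_rect (a := i.1) (b := i.2) (r := 0) (s := 0) hT
        (by simpa using hN i h.1) (by simpa [h.2] using hb)
        (fun _ _ => Or.inr (Or.inr ⟨rfl, rfl⟩))
      rw [pow_zero, pow_zero, one_mul, one_mul] at hm
      obtain ⟨F, -, hF⟩ := exists_slice_x hm p.1.2
      exact ⟨F, fun _ _ => hF⟩
    · exact ⟨0, fun h1 h2 => absurd ⟨h1, h2⟩ h⟩
  choose F hF using hsl
  obtain ⟨G, hG, hG'⟩ := exists_slice_x (hT _ (polyProd_mem_rect (U := U)
    (P := (Polynomial.X - Polynomial.C p.1.1) ^ N) (Q := (Polynomial.X - Polynomial.C p.1.2) ^ b)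
    (by simp) (by simpa using hb))) p.1.2
  -- `H` is the cofactor of `(x-z)^(N-a)`. The subtraction `a - i.1` does not truncate, since `i.2 =
  -- b` and total order at most `a + b` give `i.1 ≤ a`.
  set H : Polynomial ℂ := ∑ i ∈ f.support, if i.2 = b then
    Polynomial.C ((i.1.factorial : ℂ) * (N.choose i.1 : ℂ) * b.factorial) *
      (Polynomial.X - Polynomial.C p.1.1) ^ (a - i.1) * F i else 0 with hH
  have hH0 : H = 0 := by
    refine eq_zero_of_pow_mul_eval (infinite_slice_x p) (z := p.1.1) (n := N - a) (G := G)
      (by omega) fun w hw => ?_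
    rw [← hG' ⟨_, hw⟩ rfl, diffOp, diffOp_polyProd, Finsupp.sum, hH, Polynomial.eval_finsetSum,
      Finset.mul_sum]
    refine Finset.sum_congr rfl fun i hi => ?_
    rw [coeff_taylor_sub_pow, coeff_taylor_sub_pow, sub_self]
    by_cases h : i.2 = b
    · have hia := hf i hi
      rw [if_pos h, hF i hi h ⟨_, hw⟩ rfl, h, Nat.sub_self, Nat.choose_self,
        show N - i.1 = (N - a) + (a - i.1) by omega, pow_add]
      simp
      ring
    · rw [if_neg h, Polynomial.eval_zero, mul_zero]
      rcases lt_or_gt_of_ne h with h | h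
      · rw [zero_pow (by omega)]; ring
      · rw [Nat.choose_eq_zero_of_lt h]; simp
  by_cases hab : (a, b) ∈ f.support
  swap
  · rw [Finsupp.notMem_support_iff.1 hab]
  have h0 : H.eval p.1.1 = (a.factorial : ℂ) * (N.choose a : ℂ) * b.factorial * (f (a, b)).1 p := by
    rw [hH, Polynomial.eval_finsetSum, Finset.sum_eq_single (a, b)]
    · rw [if_pos rfl, hF _ hab rfl p rfl]
      simp
    · intro i hi hne
      by_cases h : i.2 = b
      · have hia := hf i hi
        have : i.1 ≠ a := fun h' => hne (Prod.ext h' h)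
        rw [if_pos h, Polynomial.eval_mul, Polynomial.eval_mul, Polynomial.eval_pow,
          Polynomial.eval_sub, Polynomial.eval_X, Polynomial.eval_C, Polynomial.eval_C, sub_self,
          zero_pow (by omega)]
        ring
      · rw [if_neg h, Polynomial.eval_zero]
    · exact fun h => absurd hab h
  rw [hH0, Polynomial.eval_zero] at h0
  have hne : (a.factorial : ℂ) * (N.choose a : ℂ) * b.factorial ≠ 0 :=
    mul_ne_zero (mul_ne_zero (Nat.cast_ne_zero.2 a.factorial_ne_zero)
      (Nat.cast_ne_zero.2 (Nat.choose_pos (by omega)).ne'))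
      (Nat.cast_ne_zero.2 b.factorial_ne_zero)
  exact (mul_eq_zero.1 h0.symm).resolve_left hne

/-- The divisibility argument of `top_coeff_eq_zero_x` with the variables exchanged. -/
theorem top_coeff_eq_zero_y {U : Dom} {f : ℕ × ℕ →₀ Smooth U} {N N' M M' a b : ℕ}
    (hT : ∀ g ∈ rect U N M, diffOp U f g ∈ rect U N' M') (hM : ∀ i ∈ f.support, i.2 ≤ M)
    (hf : ∀ i ∈ f.support, i.1 + i.2 ≤ a + b) (ha : a ≤ N) (hb : M' + b < M) :
    f (a, b) = 0 := by
  refine Subtype.ext (funext fun p => ?_)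
  have hsl : ∀ i : ℕ × ℕ, ∃ F : Polynomial ℂ, i ∈ f.support → i.1 = a →
      ∀ q : U, q.1.1 = p.1.1 → (f i).1 q = F.eval q.1.2 := by
    intro i
    by_cases h : i ∈ f.support ∧ i.1 = a
    · have hm := coeff_mem_rect (a := i.1) (b := i.2) (r := 0) (s := 0) hT
        (by simpa [h.2] using ha) (by simpa using hM i h.1)
        (fun _ _ => Or.inr (Or.inr ⟨rfl, rfl⟩))
      rw [pow_zero, pow_zero, one_mul, one_mul] at hm
      obtain ⟨F, -, hF⟩ := exists_slice_y hm p.1.1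
      exact ⟨F, fun _ _ => hF⟩
    · exact ⟨0, fun h1 h2 => absurd ⟨h1, h2⟩ h⟩
  choose F hF using hsl
  obtain ⟨G, hG, hG'⟩ := exists_slice_y (hT _ (polyProd_mem_rect (U := U)
    (P := (Polynomial.X - Polynomial.C p.1.1) ^ a) (Q := (Polynomial.X - Polynomial.C p.1.2) ^ M)
    (by simpa using ha) (by simp))) p.1.1
  set H : Polynomial ℂ := ∑ i ∈ f.support, if i.1 = a then
    Polynomial.C ((i.2.factorial : ℂ) * (M.choose i.2 : ℂ) * a.factorial) *
      (Polynomial.X - Polynomial.C p.1.2) ^ (b - i.2) * F i else 0 with hH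
  have hH0 : H = 0 := by
    refine eq_zero_of_pow_mul_eval (infinite_slice_y p) (z := p.1.2) (n := M - b) (G := G)
      (by omega) fun w hw => ?_
    rw [← hG' ⟨_, hw⟩ rfl, diffOp, diffOp_polyProd, Finsupp.sum, hH, Polynomial.eval_finsetSum,
      Finset.mul_sum]
    refine Finset.sum_congr rfl fun i hi => ?_
    rw [coeff_taylor_sub_pow, coeff_taylor_sub_pow, sub_self]
    by_cases h : i.1 = a
    · have hia := hf i hi
      rw [if_pos h, hF i hi h ⟨_, hw⟩ rfl, h, Nat.sub_self, Nat.choose_self,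
        show M - i.2 = (M - b) + (b - i.2) by omega, pow_add]
      simp
      ring
    · rw [if_neg h, Polynomial.eval_zero, mul_zero]
      rcases lt_or_gt_of_ne h with h | h
      · rw [zero_pow (by omega)]; ring
      · rw [Nat.choose_eq_zero_of_lt h]; simp
  by_cases hab : (a, b) ∈ f.support
  swap
  · rw [Finsupp.notMem_support_iff.1 hab]
  have h0 : H.eval p.1.2 = (b.factorial : ℂ) * (M.choose b : ℂ) * a.factorial * (f (a, b)).1 p := by
    rw [hH, Polynomial.eval_finsetSum, Finset.sum_eq_single (a, b)]
    · rw [if_pos rfl, hF _ hab rfl p rfl]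
      simp
    · intro i hi hne
      by_cases h : i.1 = a
      · have hia := hf i hi
        have : i.2 ≠ b := fun h' => hne (Prod.ext h h')
        rw [if_pos h, Polynomial.eval_mul, Polynomial.eval_mul, Polynomial.eval_pow,
          Polynomial.eval_sub, Polynomial.eval_X, Polynomial.eval_C, Polynomial.eval_C, sub_self,
          zero_pow (by omega)]
        ring
      · rw [if_neg h, Polynomial.eval_zero]
    · exact fun h => absurd hab h
  rw [hH0, Polynomial.eval_zero] at h0
  have hne : (b.factorial : ℂ) * (M.choose b : ℂ) * a.factorial ≠ 0 :=
    mul_ne_zero (mul_ne_zero (Nat.cast_ne_zero.2 b.factorial_ne_zero)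
      (Nat.cast_ne_zero.2 (Nat.choose_pos (by omega)).ne'))
      (Nat.cast_ne_zero.2 a.factorial_ne_zero)
  exact (mul_eq_zero.1 h0.symm).resolve_left hne

/-- A leading coefficient is a combination of monomials of bounded degree. -/
theorem top_coeff_mem {U : Dom} {f : ℕ × ℕ →₀ Smooth U} {N N' M M' a b : ℕ}
    (hT : ∀ g ∈ rect U N M, diffOp U f g ∈ rect U N' M')
    (hf : ∀ i ∈ f.support, i.1 + i.2 ≤ a + b) (ha : a ≤ N) (hb : b ≤ M) :
    f (a, b) ∈ Submodule.span ℂ {g | ∃ u v : ℕ, u + N ≤ N' + 2 * a ∧ v + M ≤ M' + 2 * b ∧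
      g = x U ^ u * y U ^ v} := by
  have h1 := coeff_mem_rect (a := a) (b := b) (r := 0) (s := 0) hT (by omega) (by omega)
    (fun _ _ => Or.inr (Or.inr ⟨rfl, rfl⟩))
  rw [pow_zero, pow_zero, one_mul, one_mul] at h1
  -- The largest monomial factor that keeps the test function in `R_{N,M}`. It is admissible because
  -- an index of order at most `a + b` other than `(a, b)` has a component smaller than `a` or `b`.
  have h2 := coeff_mem_rect (a := a) (b := b) (r := N - a) (s := M - b) hT (by omega) (by omega)
    (fun i hi => by
      have h := hf i hi
      by_cases h' : i = (a, b)
      · exact Or.inr (Or.inl h')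
      · refine Or.inl ?_
        by_contra! hc
        exact h' (Prod.ext (by omega) (by omega)))
  refine Submodule.span_mono ?_ (mem_span_of_monomial_mul_mem h1 h2)
  rintro g ⟨u, v, hu, hv, rfl⟩
  exact ⟨u, v, by omega, by omega, rfl⟩

/-! ### Reduction of a scalar operator to products of one-variable operators. -/

/-- The span of the operators `g ∂_x^i ∂_y^j` with `R i j`. -/
def diffSpan (U : Dom) (R : ℕ → ℕ → Prop) : Submodule ℂ (Op U) :=
  Submodule.span ℂ {T | ∃ (g : Smooth U) (i j : ℕ), R i j ∧ T = mulOp U g * dx U ^ i * dy U ^ j}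

theorem diffOp_single (U : Dom) (i : ℕ × ℕ) (g : Smooth U) :
    diffOp U (Finsupp.single i g) = mulOp U g * dx U ^ i.1 * dy U ^ i.2 := by
  rw [diffOp, Finsupp.sum_single_index]
  rw [mulOp_zero, zero_mul, zero_mul]

theorem diffOp_add (U : Dom) (f g : ℕ × ℕ →₀ Smooth U) :
    diffOp U (f + g) = diffOp U f + diffOp U g := by
  refine Finsupp.sum_add_index' (fun i => ?_) fun i a b => ?_
  · rw [mulOp_zero, zero_mul, zero_mul]
  · rw [← add_mul, ← add_mul]
    congr 2
    exact LinearMap.ext fun h => add_mul a b h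

theorem diffOp_smul (U : Dom) (c : ℂ) (f : ℕ × ℕ →₀ Smooth U) :
    diffOp U (c • f) = c • diffOp U f := by
  rw [diffOp, Finsupp.sum_smul_index' (fun i => by rw [mulOp_zero, zero_mul, zero_mul]), diffOp,
    Finsupp.smul_sum]
  refine Finsupp.sum_congr fun i _ => ?_
  rw [← smul_mul_assoc, ← smul_mul_assoc]
  congr 2
  exact LinearMap.ext fun h => smul_mul_assoc c (f i) h

theorem isDiffOpOn_of_mem_diffSpan {U : Dom} {R : ℕ → ℕ → Prop} {T : Op U}
    (hT : T ∈ diffSpan U R) : IsDiffOpOn U R T := by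
  induction hT using Submodule.span_induction with
  | mem T hT =>
    obtain ⟨g, i, j, hR, rfl⟩ := hT
    refine ⟨Finsupp.single (i, j) g, fun p hp => ?_, (diffOp_single U (i, j) g).symm⟩
    rw [Finset.mem_singleton.1 (Finsupp.support_single_subset hp)]
    exact hR
  | zero => exact ⟨0, by simp, rfl⟩
  | add S T _ _ hS hT =>
    obtain ⟨f, hf, rfl⟩ := hS
    obtain ⟨g, hg, rfl⟩ := hT
    classical
    refine ⟨f + g, fun p hp => ?_, (diffOp_add U f g).symm⟩
    rcases Finset.mem_union.1 (Finsupp.support_add hp) with h | h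
    · exact hf p h
    · exact hg p h
  | smul c T _ hT =>
    obtain ⟨f, hf, rfl⟩ := hT
    exact ⟨c • f, fun p hp => hf p (Finsupp.support_smul hp), (diffOp_smul U c f).symm⟩

theorem commute_dx_pow_y_pow (U : Dom) (i v : ℕ) : Commute (dx U ^ i) (mulOp U (y U) ^ v) :=
  (commute_dx_y U).pow_pow i v

theorem mul_mem_diffSpan {U : Dom} {R : ℕ → ℕ → Prop} {a b : ℕ} {P Q : Op U}
    (hP : P ∈ ordLT (mulOp U (x U)) (dx U) a) (hQ : Q ∈ ordLT (mulOp U (y U)) (dy U) b)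
    (hR : ∀ i j, i < a → j < b → R i j) : P * Q ∈ diffSpan U R := by
  have h := Submodule.mul_mem_mul hP hQ
  rw [ordLT, ordLT, Submodule.span_mul_span] at h
  refine Submodule.span_mono ?_ h
  rintro _ ⟨_, ⟨u, i, hi, rfl⟩, _, ⟨v, j, hj, rfl⟩, rfl⟩
  refine ⟨x U ^ u * y U ^ v, i, j, hR i j hi hj, ?_⟩
  show mulOp U (x U) ^ u * dx U ^ i * (mulOp U (y U) ^ v * dy U ^ j) = _
  rw [mulOp_mul, mulOp_pow, mulOp_pow, mul_assoc, ← mul_assoc (dx U ^ i),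
    (commute_dx_pow_y_pow U i v).eq]
  simp only [mul_assoc]

/-- With `p`, `q` the leading terms of `P`, `Q`, each correction has a factor of lower order. -/
theorem mul_eq_add_smul {R : Type*} [Ring R] [Algebra ℂ R] (P Q p q : R) :
    p * q = P * Q + (-1 : ℂ) • ((P - p) * Q + p * (Q - q)) := by
  rw [neg_one_smul]
  noncomm_ring

/-- Products of operators adapted to the order filtrations in `x` and in `y` span the operators
between rectangular modules, compatibly with the total order. -/
theorem diffOp_mem_span_products {U : Dom} {N N' M M' : ℕ} {BX BY : ℕ → Set (Op U)}
    (hX : ∀ a u, a ≤ N → N ≤ N' + a → u + N ≤ N' + 2 * a →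
      ∃ P ∈ BX a, HasLead (mulOp U (x U)) (dx U) P u a ∧ MapsX U P N N')
    (hY : ∀ b v, b ≤ M → M ≤ M' + b → v + M ≤ M' + 2 * b →
      ∃ P ∈ BY b, HasLead (mulOp U (y U)) (dy U) P v b ∧ MapsY U P M M') (k : ℕ)
    (f : ℕ × ℕ →₀ Smooth U) (hf : ∀ i ∈ f.support, i.1 ≤ N ∧ i.2 ≤ M ∧ i.1 + i.2 < k)
    (hT : ∀ g ∈ rect U N M, diffOp U f g ∈ rect U N' M') :
    diffOp U f ∈ Submodule.span ℂ {T | ∃ a b, a + b < k ∧ ∃ P ∈ BX a, ∃ Q ∈ BY b, T = P * Q} := by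
  induction k generalizing f with
  | zero =>
    have h0 : f = 0 := Finsupp.support_eq_empty.1
      (Finset.eq_empty_of_forall_notMem fun i hi => absurd (hf i hi).2.2 (Nat.not_lt_zero _))
    rw [h0, diffOp, Finsupp.sum_zero_index]
    exact zero_mem _
  | succ k ih =>
    -- The mapping property is built into `W`, so that the remainder in `L` inherits it by
    -- subtraction. `L` also records `i ≤ N` and `j ≤ M`, which the induction needs.
    set W : Submodule ℂ (Op U) := Submodule.span ℂ {T | (∃ a b, a + b < k + 1 ∧ ∃ P ∈ BX a,
      ∃ Q ∈ BY b, T = P * Q) ∧ ∀ g ∈ rect U N M, T g ∈ rect U N' M'} with hW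
    set L : Submodule ℂ (Op U) := diffSpan U fun i j => i ≤ N ∧ j ≤ M ∧ i + j < k with hL
    have hterm : ∀ i ∈ f.support, mulOp U (f i) * dx U ^ i.1 * dy U ^ i.2 ∈ W ⊔ L := by
      rintro ⟨a, b⟩ hi
      obtain ⟨ha, hb, hab⟩ := hf _ hi
      dsimp only at ha hb hab ⊢
      rcases (Nat.lt_succ_iff.1 hab).lt_or_eq with hlt | heq
      · exact Submodule.mem_sup_right (Submodule.subset_span ⟨_, a, b, ⟨ha, hb, hlt⟩, rfl⟩)
      have htop : ∀ i ∈ f.support, i.1 + i.2 ≤ a + b := fun i hi => by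
        have := (hf i hi).2.2; omega
      have haN : N ≤ N' + a := by
        by_contra! h
        exact Finsupp.mem_support_iff.1 hi
          (top_coeff_eq_zero_x hT (fun i hi => (hf i hi).1) htop hb h)
      have hbM : M ≤ M' + b := by
        by_contra! h
        exact Finsupp.mem_support_iff.1 hi
          (top_coeff_eq_zero_y hT (fun i hi => (hf i hi).2.1) htop ha h)
      have hmem := top_coeff_mem hT htop ha hb
      -- Membership in `W ⊔ L` is linear in the coefficient, so a single monomial `x^u y^v`
      -- suffices.
      generalize f (a, b) = g at hmem
      induction hmem using Submodule.span_induction with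
      | mem g hg =>
        obtain ⟨u, v, hu, hv, rfl⟩ := hg
        obtain ⟨P, hPB, hPL, hPm⟩ := hX a u ha haN hu
        obtain ⟨Q, hQB, hQL, hQm⟩ := hY b v hb hbM hv
        have e : mulOp U (x U ^ u * y U ^ v) * dx U ^ a * dy U ^ b = P * Q + (-1 : ℂ) •
            ((P - mulOp U (x U) ^ u * dx U ^ a) * Q +
            mulOp U (x U) ^ u * dx U ^ a * (Q - mulOp U (y U) ^ v * dy U ^ b)) := by
          rw [mulOp_mul, mulOp_pow, mulOp_pow, mul_assoc (mulOp U (x U) ^ u),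
            ← (commute_dx_pow_y_pow U a v).eq, ← mul_assoc, mul_assoc _ (mulOp U (y U) ^ v)]
          exact mul_eq_add_smul P Q _ _
        rw [e]
        have hPQ : P * Q ∈ W := Submodule.subset_span
          ⟨⟨a, b, hab, P, hPB, Q, hQB, rfl⟩, fun g hg => hPm _ _ (hQm _ _ hg)⟩
        refine add_mem (Submodule.mem_sup_left hPQ)
          (Submodule.smul_mem _ _ (Submodule.mem_sup_right (add_mem ?_ ?_)))
        · exact mul_mem_diffSpan hPL hQL.mem fun i j hi hj => ⟨by omega, by omega, by omega⟩
        · exact mul_mem_diffSpan (mem_ordLT a.lt_succ_self) hQL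
            fun i j hi hj => ⟨by omega, by omega, by omega⟩
      | zero => rw [mulOp_zero, zero_mul, zero_mul]; exact zero_mem _
      | add g h _ _ hg hh =>
        rw [show mulOp U (g + h) = mulOp U g + mulOp U h from LinearMap.ext fun l => add_mul g h l,
          add_mul, add_mul]
        exact add_mem hg hh
      | smul c g _ hg =>
        rw [show mulOp U (c • g) = c • mulOp U g from LinearMap.ext fun l => smul_mul_assoc c g l,
          smul_mul_assoc, smul_mul_assoc]
        exact Submodule.smul_mem _ c hg
    obtain ⟨w, hw, l, hl, hwl⟩ := Submodule.mem_sup.1 (sum_mem hterm : diffOp U f ∈ W ⊔ L)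
    have hwm : ∀ g ∈ rect U N M, w g ∈ rect U N' M' := by
      intro g hg
      clear hwl
      induction hw using Submodule.span_induction with
      | mem w hw => exact hw.2 g hg
      | zero => exact zero_mem _
      | add v w _ _ hv hw => exact add_mem hv hw
      | smul c v _ hv => exact Submodule.smul_mem _ c hv
    replace hwl : w + l = diffOp U f := hwl
    obtain ⟨f', hf', hl'⟩ := isDiffOpOn_of_mem_diffSpan hl
    replace hl' : l = diffOp U f' := hl'
    subst hl'
    -- The remainder is a difference of two operators that map `R_{N,M}` to `R_{N',M'}`.
    have hlm : ∀ g ∈ rect U N M, diffOp U f' g ∈ rect U N' M' := fun g hg => by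
      have h := sub_mem (hT g hg) (hwm g hg)
      rwa [← hwl, LinearMap.add_apply, add_sub_cancel_left] at h
    rw [← hwl]
    refine add_mem (Submodule.span_mono (fun T hT => hT.1) hw) (Submodule.span_mono ?_
      (ih f' hf' hlm))
    rintro T ⟨a, b, hab, h⟩
    exact ⟨a, b, by omega, h⟩

/-! ### One-variable operators with prescribed leading terms. -/

/-- The products of a factor `L α` of order `o` with powers of the `sl₂` operators, in the form
in which they enter the basis. -/
def family {A : Type*} [Ring A] [Algebra ℂ A] (X D : A) (L : ℕ → A) (c : ℂ) (σ : Sgn)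
    (Δ o a : ℕ) : Set A :=
  {P | ∃ (μ : Sgn) (i s : ℕ), o + i + s = a ∧ P = L 0 * (slPM X D c μ ^ i * slZero X D c ^ s)} ∪
  {P | ∃ α i : ℕ, 1 ≤ α ∧ α ≤ Δ ∧ o + i = a ∧ P = L α * slPM X D c σ ^ i}

section Family

variable {A : Type*} [Ring A] [Algebra ℂ A] {X D : A}

theorem hasLead_slPM (c : ℂ) (μ : Sgn) : ∃ u, HasLead X D (slPM X D c μ) u 1 := by
  cases μ
  · exact ⟨2, hasLead_slPM_plus c⟩
  · exact ⟨0, hasLead_slPM_minus c⟩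

theorem family_subset_ordLT (h : D * X = X * D + 1) {L : ℕ → A} {c : ℂ} {σ : Sgn} {Δ o a : ℕ}
    (hL : ∀ α ≤ Δ, ∃ u, HasLead X D (L α) u o) {P : A} (hP : P ∈ family X D L c σ Δ o a) :
    P ∈ ordLT X D (a + 1) := by
  rcases hP with ⟨μ, i, s, rfl, rfl⟩ | ⟨α, i, -, hα, rfl, rfl⟩
  · obtain ⟨u, hu⟩ := hL 0 (Nat.zero_le _)
    obtain ⟨v, hv⟩ := hasLead_slPM (X := X) (D := D) c μ
    have := (hu.mul h ((hv.pow h i).mul h ((hasLead_slZero c).pow h s))).mem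
    rwa [mul_one, mul_one, ← add_assoc] at this
  · obtain ⟨u, hu⟩ := hL α hα
    obtain ⟨v, hv⟩ := hasLead_slPM (X := X) (D := D) c σ
    have := (hu.mul h (hv.pow h i)).mem
    rwa [mul_one] at this

/-- The symbols of `J^-`, `J^0`, `J^+` are `D`, `XD`, `X²D`. For `u ≤ a` the word is `(J^-)^(a-u)
(J^0)^u`; for `u ≥ a` it is `(J^+)^(u-a) (J^0)^(2a-u)`. -/
theorem exists_hasLead_sl (h : D * X = X * D + 1) (c : ℂ) {a u : ℕ} (hu : u ≤ 2 * a) :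
    ∃ (μ : Sgn) (i s : ℕ), i + s = a ∧
      HasLead X D (slPM X D c μ ^ i * slZero X D c ^ s) u a := by
  rcases le_total u a with hua | hua
  · refine ⟨.minus, a - u, u, by omega, ?_⟩
    have := ((hasLead_slPM_minus (X := X) (D := D) c).pow h (a - u)).mul h
      ((hasLead_slZero c).pow h u)
    convert this using 1 <;> omega
  · refine ⟨.plus, u - a, 2 * a - u, by omega, ?_⟩
    have := ((hasLead_slPM_plus (X := X) (D := D) c).pow h (u - a)).mul h
      ((hasLead_slZero c).pow h (2 * a - u))
    convert this using 1 <;> omega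

end Family

section LadderFamily

variable {V ι : Type*} [AddCommGroup V] [Module ℂ V] {e : ι → ℕ → V} {X D : Module.End ℂ V}

/-- Up to `u = 2a` an `sl₂` word suffices; beyond that the excess is supplied by `X^(u-2a)` in front
of `(J^+)^a`. The index `j` lets one operator serve all rows of monomials at once. -/
theorem exists_raising (h : D * X = X * D + 1) (hX : ∀ j p, X (e j p) = e j (p + 1))
    (hD : ∀ j p, D (e j p) = (p : ℂ) • e j (p - 1)) {N Δ a u : ℕ} (hu : u ≤ Δ + 2 * a) :
    ∃ P ∈ family X D (fun α => X ^ α) N .plus Δ 0 a, HasLead X D P u a ∧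
      ∀ j, MapsLadder (e j) P N (N + Δ) := by
  have hmono : ∀ j P N' , N' ≤ N + Δ → MapsLadder (e j) P N N' → MapsLadder (e j) P N (N + Δ) :=
    fun j P N' hN hP p hp => Submodule.span_mono (Set.image_mono (Set.Iic_subset_Iic.2 hN)) (hP p hp)
  rcases le_or_gt u (2 * a) with hua | hua
  · obtain ⟨μ, i, s, his, hl⟩ := exists_hasLead_sl h (N : ℂ) hua
    refine ⟨_, Or.inl ⟨μ, i, s, by omega, rfl⟩, ?_, fun j => hmono j _ N (by omega) ?_⟩
    · simpa using hl
    · simpa using ((mapsLadder_slPM (hX j) (hD j) N μ).pow i).mul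
        ((mapsLadder_slZero (hX j) (hD j) (N : ℂ) N).pow s)
  · refine ⟨_, Or.inr ⟨u - 2 * a, a, by omega, by omega, by omega, rfl⟩, ?_, fun j =>
      hmono j _ (N + (u - 2 * a)) (by omega) ?_⟩
    · have := (hasLead_pow_left (X := X) (D := D) (u - 2 * a)).mul h
        ((hasLead_slPM_plus (N : ℂ)).pow h a)
      convert this using 1 <;> omega
    · exact (mapsLadder_pow_left (hX j) N _).mul ((mapsLadder_slPM (hX j) (hD j) N .plus).pow a)

/-- The symbol of `qbar` with index `α` is `X^(Δ-α) D^Δ`. For `u ≥ Δ` take `α = 0` and an `sl₂` word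
for the rest; for `u < Δ` take `α = Δ - u` followed by `(J^-)^(a-Δ)`. -/
theorem exists_lowering (h : D * X = X * D + 1) (hX : ∀ j p, X (e j p) = e j (p + 1))
    (hD : ∀ j p, D (e j p) = (p : ℂ) • e j (p - 1)) {n Δ a u : ℕ} (hΔ : Δ ≤ n) (ha : Δ ≤ a)
    (hu : u + Δ ≤ 2 * a) :
    ∃ P ∈ family X D (fun α => qbar X D n Δ α) n .minus Δ Δ a, HasLead X D P u a ∧
      ∀ j, MapsLadder (e j) P n (n - Δ) := by
  rcases le_or_gt Δ u with hua | hua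
  · obtain ⟨μ, i, s, his, hl⟩ := exists_hasLead_sl h (n : ℂ) (a := a - Δ) (u := u - Δ) (by omega)
    refine ⟨_, Or.inl ⟨μ, i, s, by omega, rfl⟩, ?_, fun j => ?_⟩
    · have := (hasLead_qbar h n (Nat.zero_le Δ)).mul h hl
      convert this using 1 <;> omega
    · exact (mapsLadder_qbar (hX j) (hD j) hΔ (Nat.zero_le Δ)).mul
        (((mapsLadder_slPM (hX j) (hD j) n μ).pow i).mul
          ((mapsLadder_slZero (hX j) (hD j) (n : ℂ) n).pow s))
  · refine ⟨_, Or.inr ⟨Δ - u, a - Δ, by omega, by omega, by omega, rfl⟩, ?_, fun j => ?_⟩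
    · have := (hasLead_qbar h n (Nat.sub_le Δ u)).mul h
        ((hasLead_slPM_minus (n : ℂ)).pow h (a - Δ))
      convert this using 1 <;> omega
    · exact (mapsLadder_qbar (hX j) (hD j) hΔ (Nat.sub_le Δ u)).mul
        ((mapsLadder_slPM (hX j) (hD j) n .minus).pow _)

end LadderFamily

theorem exists_raising_x (U : Dom) {N Δ a u : ℕ} (hu : u ≤ Δ + 2 * a) :
    ∃ P ∈ family (mulOp U (x U)) (dx U) (fun α => mulOp U (x U) ^ α) N .plus Δ 0 a,
      HasLead (mulOp U (x U)) (dx U) P u a ∧ MapsX U P N (N + Δ) := by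
  obtain ⟨P, h1, h2, h3⟩ := exists_raising (e := fun j i => x U ^ i * y U ^ j) (dx_mul_x U)
    (fun j i => mulOp_x_monomial U i j) (fun j i => dx_monomial U i j) (N := N) hu
  exact ⟨P, h1, h2, mapsX_of_ladder h3⟩

theorem exists_raising_y (U : Dom) {N Δ a u : ℕ} (hu : u ≤ Δ + 2 * a) :
    ∃ P ∈ family (mulOp U (y U)) (dy U) (fun α => mulOp U (y U) ^ α) N .plus Δ 0 a,
      HasLead (mulOp U (y U)) (dy U) P u a ∧ MapsY U P N (N + Δ) := by
  obtain ⟨P, h1, h2, h3⟩ := exists_raising (e := fun i j => x U ^ i * y U ^ j) (dy_mul_y U)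
    (fun i j => mulOp_y_monomial U i j) (fun i j => dy_monomial U i j) (N := N) hu
  exact ⟨P, h1, h2, mapsY_of_ladder h3⟩

theorem exists_lowering_x (U : Dom) {n Δ a u : ℕ} (hΔ : Δ ≤ n) (ha : Δ ≤ a)
    (hu : u + Δ ≤ 2 * a) :
    ∃ P ∈ family (mulOp U (x U)) (dx U) (fun α => qbar (mulOp U (x U)) (dx U) n Δ α) n .minus Δ Δ a,
      HasLead (mulOp U (x U)) (dx U) P u a ∧ MapsX U P n (n - Δ) := by
  obtain ⟨P, h1, h2, h3⟩ := exists_lowering (e := fun j i => x U ^ i * y U ^ j) (dx_mul_x U)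
    (fun j i => mulOp_x_monomial U i j) (fun j i => dx_monomial U i j) hΔ ha hu
  exact ⟨P, h1, h2, mapsX_of_ladder h3⟩

theorem exists_lowering_y (U : Dom) {n Δ a u : ℕ} (hΔ : Δ ≤ n) (ha : Δ ≤ a)
    (hu : u + Δ ≤ 2 * a) :
    ∃ P ∈ family (mulOp U (y U)) (dy U) (fun α => qbar (mulOp U (y U)) (dy U) n Δ α) n .minus Δ Δ a,
      HasLead (mulOp U (y U)) (dy U) P u a ∧ MapsY U P n (n - Δ) := by
  obtain ⟨P, h1, h2, h3⟩ := exists_lowering (e := fun i j => x U ^ i * y U ^ j) (dy_mul_y U)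
    (fun i j => mulOp_y_monomial U i j) (fun i j => dy_monomial U i j) hΔ ha hu
  exact ⟨P, h1, h2, mapsY_of_ladder h3⟩

/-! ### Passage from scalar entries to matrices and the basis. -/

section MatrixAlgebra

theorem single_mul_diagonal {A : Type*} [Semiring A] (i j : Fin 2) (c : A) (d : Fin 2 → A) :
    Matrix.single i j c * Matrix.diagonal d = Matrix.single i j (c * d j) := by
  ext a b
  rw [Matrix.mul_diagonal, Matrix.single_apply, Matrix.single_apply]
  split_ifs with h
  · rw [h.2]
  · rw [zero_mul]

/-- The diagonal projections are `(1 ± σ₃)/2`; this is the role of `J̃` in the basis. -/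
theorem single_self_eq {A : Type*} [Ring A] [Algebra ℂ A] (l : Fin 2) (w : Fin 2 → A) : Matrix.single l l (w l) =
    (1 / 2 : ℂ) • Matrix.diagonal w + (![1 / 2, -(1 / 2)] l : ℂ) •
      (Matrix.diagonal ![1, -1] * Matrix.diagonal w) := by
  have h : ∀ c : A, c = (2⁻¹ : ℂ) • c + (2⁻¹ : ℂ) • c := fun c => by
    rw [← add_smul, ← two_mul, mul_inv_cancel₀ two_ne_zero, one_smul]
  rw [Matrix.diagonal_mul_diagonal]
  ext a b
  fin_cases l <;> fin_cases a <;> fin_cases b <;> simp [← h]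

theorem mul_mul_mul_comm_of_commute {A : Type*} [Semiring A] {P Q J K : A} (h : Commute Q J) :
    P * J * (Q * K) = P * Q * J * K := by
  rw [mul_assoc P J, ← mul_assoc J, ← h.eq]
  simp only [mul_assoc]

variable {A : Type*} [Ring A] [Algebra ℂ A] {X D Z : A}

theorem commute_slPM (hX : Commute Z X) (hD : Commute Z D) (c : ℂ) (μ : Sgn) :
    Commute Z (slPM X D c μ) := by
  cases μ
  · exact ((hX.pow_right 2).mul_right hD).sub_right (hX.smul_right c)
  · exact hD

theorem commute_slZero (hX : Commute Z X) (hD : Commute Z D) (c : ℂ) :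
    Commute Z (slZero X D c) :=
  (hX.mul_right hD).sub_right (Algebra.commutes _ _).symm

theorem commute_qbar (hX : Commute Z X) (hD : Commute Z D) (n Δ α : ℕ) :
    Commute Z (qbar X D n Δ α) := by
  rw [qbar_eq]
  refine (Commute.list_prod_right _ _ fun P hP => ?_).mul_right (hD.pow_right α)
  obtain ⟨k, _, rfl⟩ := List.mem_map.1 hP
  exact (hX.mul_right hD).sub_right (Algebra.commutes _ _).symm

end MatrixAlgebra

/-- The row of `σ^±`. -/
def Sgn.row : Sgn → Fin 2
  | .plus => 0
  | .minus => 1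

/-- The column of `σ^±`. -/
def Sgn.col : Sgn → Fin 2
  | .plus => 1
  | .minus => 0

/-- The `x`-factor of `Q^±_{αβ}`. -/
def factorX (U : Dom) (n Δ : ℕ) (ε : Sgn) (α : ℕ) : Op U :=
  match ε with
  | .plus => qbar (mulOp U (x U)) (dx U) n Δ α
  | .minus => mulOp U (x U) ^ α

/-- The `y`-factor of `Q^±_{αβ}`. -/
def factorY (U : Dom) (m Γ : ℕ) (ε : Sgn) (β : ℕ) : Op U :=
  match ε with
  | .plus => mulOp U (y U) ^ β
  | .minus => qbar (mulOp U (y U)) (dy U) m Γ β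

/-- The parameters of `S^±`, `S^0`. -/
def xPar (n Δ : ℕ) : Fin 2 → ℂ := ![(n : ℂ) - Δ, n]

/-- The parameters of `T^±`, `T^0`. -/
def yPar (m Γ : ℕ) : Fin 2 → ℂ := ![(m : ℂ), (m : ℂ) - Γ]

theorem Q_eq (U : Dom) (n m Δ Γ : ℕ) (ε : Sgn) (α β : ℕ) : Q U n m Δ Γ ε α β =
    Matrix.single ε.row ε.col (factorX U n Δ ε α * factorY U m Γ ε β) := by
  cases ε <;> ext a b : 2 <;> fin_cases a <;> fin_cases b <;> rfl

theorem S_eq (U : Dom) (n Δ : ℕ) (μ : Sgn) : S U n Δ μ =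
    Matrix.diagonal fun l => slPM (mulOp U (x U)) (dx U) (xPar n Δ l) μ := by
  rw [S]; congr 1; funext l; fin_cases l <;> rfl

theorem S0_eq (U : Dom) (n Δ : ℕ) : S0 U n Δ =
    Matrix.diagonal fun l => slZero (mulOp U (x U)) (dx U) (xPar n Δ l) := by
  rw [S0]; congr 1; funext l; fin_cases l <;> rfl

theorem T_eq (U : Dom) (m Γ : ℕ) (μ : Sgn) : T U m Γ μ =
    Matrix.diagonal fun l => slPM (mulOp U (y U)) (dy U) (yPar m Γ l) μ := by
  rw [T]; congr 1; funext l; fin_cases l <;> rfl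

theorem T0_eq (U : Dom) (m Γ : ℕ) : T0 U m Γ =
    Matrix.diagonal fun l => slZero (mulOp U (y U)) (dy U) (yPar m Γ l) := by
  rw [T0]; congr 1; funext l; fin_cases l <;> rfl

theorem commute_factorY_x (U : Dom) (m Γ : ℕ) (ε : Sgn) (β : ℕ) :
    Commute (mulOp U (x U)) (factorY U m Γ ε β) := by
  cases ε
  · exact (mulOp_comm U _ _).pow_right β
  · exact commute_qbar (mulOp_comm U _ _) (commute_dy_x U).symm m Γ β

theorem commute_factorY_dx (U : Dom) (m Γ : ℕ) (ε : Sgn) (β : ℕ) :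
    Commute (dx U) (factorY U m Γ ε β) := by
  cases ε
  · exact (commute_dx_y U).pow_right β
  · exact commute_qbar (commute_dx_y U) (commute_dx_dy U) m Γ β

theorem commute_factorY_slPM (U : Dom) (m Γ : ℕ) (ε : Sgn) (β i : ℕ) (c : ℂ) (μ : Sgn) :
    Commute (factorY U m Γ ε β) (slPM (mulOp U (x U)) (dx U) c μ ^ i) :=
  (commute_slPM (commute_factorY_x U m Γ ε β).symm (commute_factorY_dx U m Γ ε β).symm c
    μ).pow_right i

theorem commute_factorY_slZero (U : Dom) (m Γ : ℕ) (ε : Sgn) (β s : ℕ) (c : ℂ) :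
    Commute (factorY U m Γ ε β) (slZero (mulOp U (x U)) (dx U) c ^ s) :=
  (commute_slZero (commute_factorY_x U m Γ ε β).symm (commute_factorY_dx U m Γ ε β).symm
    c).pow_right s

/-- The `y`-factor of `Q` commutes with the `x`-operators, so `P * P'` can be regrouped as `Q` times
powers of `S` and `T`. The two shapes of `P` and the two of `P'` produce the four families of
monomials. -/
theorem single_mem_basisR {U : Dom} {n m Δ Γ : ℕ} {ε : Sgn} {o o' a b : ℕ} {P P' : Op U}
    (hP : P ∈ family (mulOp U (x U)) (dx U) (factorX U n Δ ε) (xPar n Δ ε.col) ε.opp Δ o a)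
    (hP' : P' ∈ family (mulOp U (y U)) (dy U) (factorY U m Γ ε) (yPar m Γ ε.col) ε Γ o' b) :
    Matrix.single ε.row ε.col (P * P') ∈ basisR U n m Δ Γ := by
  rcases hP with ⟨μ, i, s, -, rfl⟩ | ⟨α, i, hα, hα', -, rfl⟩ <;>
    rcases hP' with ⟨ν, j, t, -, rfl⟩ | ⟨β, j, hβ, hβ', -, rfl⟩
  · refine Or.inl (Or.inl (Or.inl ⟨_, Or.inr (Or.inr ⟨ε, rfl⟩), μ, ν, i, s, j, t, ?_⟩))
    rw [Q_eq, S_eq, S0_eq, T_eq, T0_eq, Matrix.diagonal_pow, Matrix.diagonal_pow,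
      Matrix.diagonal_pow, Matrix.diagonal_pow, single_mul_diagonal, single_mul_diagonal,
      single_mul_diagonal, single_mul_diagonal, mul_mul_mul_comm_of_commute
      ((commute_factorY_slPM U m Γ ε 0 i _ μ).mul_right (commute_factorY_slZero U m Γ ε 0 s _))]
    simp only [← mul_assoc]
    rfl
  · refine Or.inl (Or.inr ⟨ε, μ, β, i, s, j, hβ, hβ', ?_⟩)
    rw [Q_eq, S_eq, S0_eq, T_eq, Matrix.diagonal_pow, Matrix.diagonal_pow,
      Matrix.diagonal_pow, single_mul_diagonal, single_mul_diagonal,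
      single_mul_diagonal, mul_mul_mul_comm_of_commute
      ((commute_factorY_slPM U m Γ ε β i _ μ).mul_right (commute_factorY_slZero U m Γ ε β s _))]
    simp only [← mul_assoc]
    rfl
  · refine Or.inl (Or.inl (Or.inr ⟨ε, ν, α, i, j, t, hα, hα', ?_⟩))
    rw [Q_eq, S_eq, T_eq, T0_eq, Matrix.diagonal_pow, Matrix.diagonal_pow,
      Matrix.diagonal_pow, single_mul_diagonal, single_mul_diagonal,
      single_mul_diagonal, mul_mul_mul_comm_of_commute (commute_factorY_slPM U m Γ ε 0 i _ _)]
    simp only [← mul_assoc]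
    rfl
  · refine Or.inr ⟨ε, α, β, i, j, hα, hα', hβ, hβ', ?_⟩
    rw [Q_eq, S_eq, T_eq, Matrix.diagonal_pow, Matrix.diagonal_pow,
      single_mul_diagonal, single_mul_diagonal,
      mul_mul_mul_comm_of_commute (commute_factorY_slPM U m Γ ε β i _ _)]
    rfl

theorem isDiffOpOn_mul {U : Dom} {k a b : ℕ} {P P' : Op U} (hab : a + b ≤ k)
    (hP : P ∈ ordLT (mulOp U (x U)) (dx U) (a + 1))
    (hP' : P' ∈ ordLT (mulOp U (y U)) (dy U) (b + 1)) :
    IsDiffOpOn U (fun i j => i + j ≤ k) (P * P') :=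
  isDiffOpOn_of_mem_diffSpan (mul_mem_diffSpan hP hP' fun i j hi hj => by omega)

theorem isDiffOpOn_zero (U : Dom) (R : ℕ → ℕ → Prop) : IsDiffOpOn U R 0 :=
  isDiffOpOn_of_mem_diffSpan (zero_mem _)

theorem orderLE_single {U : Dom} {k : ℕ} {P : Op U} (i j : Fin 2)
    (hP : IsDiffOpOn U (fun i j => i + j ≤ k) P) : OrderLE U k (Matrix.single i j P) := by
  intro a b
  rw [Matrix.single_apply]
  split_ifs
  · exact hP
  · exact isDiffOpOn_zero U _

theorem orderLE_diagonal {U : Dom} {k : ℕ} {w : Fin 2 → Op U}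
    (hw : ∀ l, IsDiffOpOn U (fun i j => i + j ≤ k) (w l)) : OrderLE U k (Matrix.diagonal w) := by
  intro a b
  rw [Matrix.diagonal_apply]
  split_ifs
  · exact hw a
  · exact isDiffOpOn_zero U _

theorem exists_hasLead_factorX (U : Dom) (n Δ : ℕ) (ε : Sgn) {α : ℕ} (hα : α ≤ Δ) :
    ∃ u, HasLead (mulOp U (x U)) (dx U) (factorX U n Δ ε α) u
      (match ε with | .plus => Δ | .minus => 0) := by
  cases ε
  · exact ⟨_, hasLead_qbar (dx_mul_x U) n hα⟩
  · exact ⟨_, hasLead_pow_left α⟩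

theorem exists_hasLead_factorY (U : Dom) (m Γ : ℕ) (ε : Sgn) {β : ℕ} (hβ : β ≤ Γ) :
    ∃ u, HasLead (mulOp U (y U)) (dy U) (factorY U m Γ ε β) u
      (match ε with | .plus => 0 | .minus => Γ) := by
  cases ε
  · exact ⟨_, hasLead_pow_left β⟩
  · exact ⟨_, hasLead_qbar (dy_mul_y U) m hβ⟩

theorem sl_mem_ordLT {A : Type*} [Ring A] [Algebra ℂ A] {X D : A} (h : D * X = X * D + 1) (c : ℂ)
    (μ : Sgn) (i s : ℕ) : slPM X D c μ ^ i * slZero X D c ^ s ∈ ordLT X D (i + s + 1) := by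
  obtain ⟨v, hv⟩ := hasLead_slPM (X := X) (D := D) c μ
  have := ((hv.pow h i).mul h ((hasLead_slZero c).pow h s)).mem
  rwa [mul_one, mul_one] at this

theorem single_self_mem {U : Dom} {n m Δ Γ k a b : ℕ} {l : Fin 2} {P P' : Op U} (hab : a + b ≤ k)
    (hP : P ∈ family (mulOp U (x U)) (dx U) (fun α => mulOp U (x U) ^ α) (xPar n Δ l) .plus 0 0 a)
    (hP' : P' ∈ family (mulOp U (y U)) (dy U) (fun β => mulOp U (y U) ^ β) (yPar m Γ l) .plus
      0 0 b) :
    Matrix.single l l (P * P') ∈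
      Submodule.span ℂ {M | M ∈ basisR U n m Δ Γ ∧ OrderLE U k M} := by
  -- On the diagonal the degree shift is `0`, so the range `1 ≤ α ≤ 0` of the second shape is empty.
  obtain ⟨μ, i, s, hi, rfl⟩ | ⟨α, i, hα, hα', -, rfl⟩ := hP
  swap
  · omega
  obtain ⟨ν, j, t, hj, rfl⟩ | ⟨β, j, hβ, hβ', -, rfl⟩ := hP'
  swap
  · omega
  set w : Fin 2 → Op U := fun l => slPM (mulOp U (x U)) (dx U) (xPar n Δ l) μ ^ i *
    slZero (mulOp U (x U)) (dx U) (xPar n Δ l) ^ s *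
    (slPM (mulOp U (y U)) (dy U) (yPar m Γ l) ν ^ j *
    slZero (mulOp U (y U)) (dy U) (yPar m Γ l) ^ t) with hw
  have hwd : ∀ l, w l ∈ diffSpan U (fun i j => i + j ≤ k) := fun l =>
    mul_mem_diffSpan (sl_mem_ordLT (dx_mul_x U) _ μ i s) (sl_mem_ordLT (dy_mul_y U) _ ν j t)
      fun i j hi hj => by omega
  have hmat : S U n Δ μ ^ i * S0 U n Δ ^ s * T U m Γ ν ^ j * T0 U m Γ ^ t = Matrix.diagonal w := by
    rw [S_eq, S0_eq, T_eq, T0_eq, Matrix.diagonal_pow, Matrix.diagonal_pow,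
      Matrix.diagonal_pow, Matrix.diagonal_pow, Matrix.diagonal_mul_diagonal,
      Matrix.diagonal_mul_diagonal, Matrix.diagonal_mul_diagonal]
    congr 1
  have h1 : Matrix.diagonal w ∈ Submodule.span ℂ {M | M ∈ basisR U n m Δ Γ ∧ OrderLE U k M} := by
    refine Submodule.subset_span ⟨Or.inl (Or.inl (Or.inl ⟨1, Or.inl rfl, μ, ν, i, s, j, t, ?_⟩)),
      orderLE_diagonal fun l => isDiffOpOn_of_mem_diffSpan (hwd l)⟩
    rw [← hmat, one_mul]
  have h2 : Matrix.diagonal ![1, -1] * Matrix.diagonal w ∈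
      Submodule.span ℂ {M | M ∈ basisR U n m Δ Γ ∧ OrderLE U k M} := by
    refine Submodule.subset_span ⟨Or.inl (Or.inl (Or.inl ⟨Jtilde U, Or.inr (Or.inl rfl), μ, ν, i, s,
      j, t, ?_⟩)), ?_⟩
    · rw [← hmat, Jtilde]
      simp only [mul_assoc]
    · rw [Matrix.diagonal_mul_diagonal]
      refine orderLE_diagonal fun l => isDiffOpOn_of_mem_diffSpan ?_
      fin_cases l
      · simpa using hwd 0
      · have h : (-1 : Op U) * w 1 = (-1 : ℂ) • w 1 :=
          LinearMap.ext fun f => (neg_one_smul ℂ (w 1 f)).symm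
        show (-1 : Op U) * w 1 ∈ _
        rw [h]
        exact Submodule.smul_mem _ _ (hwd 1)
  have e : (fun α => mulOp U (x U) ^ α) 0 * (slPM (mulOp U (x U)) (dx U) (xPar n Δ l) μ ^ i *
      slZero (mulOp U (x U)) (dx U) (xPar n Δ l) ^ s) * ((fun β => mulOp U (y U) ^ β) 0 *
      (slPM (mulOp U (y U)) (dy U) (yPar m Γ l) ν ^ j *
      slZero (mulOp U (y U)) (dy U) (yPar m Γ l) ^ t)) = w l := by
    dsimp only
    rw [pow_zero, pow_zero, one_mul, one_mul]
  have e' : Matrix.single l l (w l) = (1 / 2 : ℂ) • Matrix.diagonal w +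
      (![1 / 2, -(1 / 2)] l : ℂ) • (Matrix.diagonal ![1, -1] * Matrix.diagonal w) :=
    single_self_eq l w
  rw [e, e']
  exact add_mem (Submodule.smul_mem _ _ h1) (Submodule.smul_mem _ _ h2)

theorem single_mem_of_mem_span {U : Dom} {W : Submodule ℂ (MatOp U)} {s : Set (Op U)} {i j : Fin 2}
    (h : ∀ P ∈ s, Matrix.single i j P ∈ W) {P : Op U} (hP : P ∈ Submodule.span ℂ s) :
    Matrix.single i j P ∈ W := by
  induction hP using Submodule.span_induction with
  | mem P hP => exact h P hP
  | zero => rw [Matrix.single_zero]; exact zero_mem _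
  | add P Q _ _ hP hQ => rw [Matrix.single_add]; exact add_mem hP hQ
  | smul c P _ hP => rw [← Matrix.smul_single]; exact Submodule.smul_mem _ c hP

theorem entry_maps {U : Dom} {n m Δ Γ : ℕ} {D : MatOp U} (hD : D ∈ complementR U n m Δ Γ)
    (i j : Fin 2) : ∀ g ∈ rect U (xDeg n Δ j) (yDeg m Γ j),
      D i j g ∈ rect U (xDeg n Δ i) (yDeg m Γ i) := by
  intro g hg
  have hv : Pi.single j g ∈ rect2 U n m Δ Γ := Submodule.mem_pi.2 fun l _ => by
    by_cases h : l = j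
    · subst h; rwa [Pi.single_eq_same]
    · rw [Pi.single_eq_of_ne h]; exact zero_mem _
  have h := Submodule.mem_pi.1 (hD.1 _ hv) i trivial
  rwa [act, Finset.sum_eq_single j (fun l _ hl => by rw [Pi.single_eq_of_ne hl, map_zero])
    (fun h => absurd (Finset.mem_univ j) h), Pi.single_eq_same] at h

theorem entry_eq_diffOp {U : Dom} {n m Δ Γ k : ℕ} {D : MatOp U} (hD : D ∈ complementR U n m Δ Γ)
    (hk : OrderLE U k D) (i j : Fin 2) : ∃ f : ℕ × ℕ →₀ Smooth U,
      (∀ p ∈ f.support, p.1 ≤ xDeg n Δ j ∧ p.2 ≤ yDeg m Γ j ∧ p.1 + p.2 < k + 1) ∧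
      D i j = diffOp U f := by
  obtain ⟨f, hf, hfD⟩ := hD.2 i j
  obtain ⟨g, hg, hgD⟩ := hk i j
  -- The bounds from the complement and from the order come with separate expansions; uniqueness of
  -- coefficients makes them one.
  obtain rfl : f = g := diffOp_injective U (hfD.symm.trans hgD)
  exact ⟨f, fun p hp => ⟨(hf p hp).1, (hf p hp).2, Nat.lt_succ_of_le (hg p hp)⟩, hfD⟩

theorem xPar_eq {n Δ : ℕ} (hΔ : Δ ≤ n) (l : Fin 2) : xPar n Δ l = (xDeg n Δ l : ℂ) := by
  fin_cases l
  · exact (Nat.cast_sub hΔ).symm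
  · rfl

theorem yPar_eq {m Γ : ℕ} (hΓ : Γ ≤ m) (l : Fin 2) : yPar m Γ l = (yDeg m Γ l : ℂ) := by
  fin_cases l
  · rfl
  · exact (Nat.cast_sub hΓ).symm

/-- `σ^+` goes from the second summand to the first, so it lowers the `x`-degree by `Δ`, while `σ^-`
raises it; hence the sign `ε.opp`. In `y` the roles are reversed and the sign is `ε`. -/
theorem exists_family_x (U : Dom) {n Δ : ℕ} (hΔ : Δ ≤ n) (ε : Sgn) (a u : ℕ)
    (ha : xDeg n Δ ε.col ≤ xDeg n Δ ε.row + a)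
    (hu : u + xDeg n Δ ε.col ≤ xDeg n Δ ε.row + 2 * a) :
    ∃ P ∈ family (mulOp U (x U)) (dx U) (factorX U n Δ ε) (xPar n Δ ε.col) ε.opp Δ
        (match ε with | .plus => Δ | .minus => 0) a,
      HasLead (mulOp U (x U)) (dx U) P u a ∧ MapsX U P (xDeg n Δ ε.col) (xDeg n Δ ε.row) := by
  rw [xPar_eq hΔ]
  cases ε
  · have ha' : n ≤ n - Δ + a := ha
    have hu' : u + n ≤ n - Δ + 2 * a := hu
    exact exists_lowering_x U hΔ (by omega) (by omega)
  · have hu' : u + (n - Δ) ≤ n + 2 * a := hu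
    have h := exists_raising_x U (N := n - Δ) (Δ := Δ) (a := a) (u := u) (by omega)
    rw [Nat.sub_add_cancel hΔ] at h
    exact h

theorem exists_family_y (U : Dom) {m Γ : ℕ} (hΓ : Γ ≤ m) (ε : Sgn) (b v : ℕ)
    (hb : yDeg m Γ ε.col ≤ yDeg m Γ ε.row + b)
    (hv : v + yDeg m Γ ε.col ≤ yDeg m Γ ε.row + 2 * b) :
    ∃ P ∈ family (mulOp U (y U)) (dy U) (factorY U m Γ ε) (yPar m Γ ε.col) ε Γ
        (match ε with | .plus => 0 | .minus => Γ) b,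
      HasLead (mulOp U (y U)) (dy U) P v b ∧ MapsY U P (yDeg m Γ ε.col) (yDeg m Γ ε.row) := by
  rw [yPar_eq hΓ]
  cases ε
  · have hv' : v + (m - Γ) ≤ m + 2 * b := hv
    have h := exists_raising_y U (N := m - Γ) (Δ := Γ) (a := b) (u := v) (by omega)
    rw [Nat.sub_add_cancel hΓ] at h
    exact h
  · have hb' : m ≤ m - Γ + b := hb
    have hv' : v + m ≤ m - Γ + 2 * b := hv
    exact exists_lowering_y U hΓ (by omega) (by omega)

theorem single_entry_mem {U : Dom} {n m Δ Γ k : ℕ} (hΔ : Δ ≤ n) (hΓ : Γ ≤ m) {D : MatOp U}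
    (hD : D ∈ complementR U n m Δ Γ) (hk : OrderLE U k D) (i j : Fin 2) :
    Matrix.single i j (D i j) ∈
      Submodule.span ℂ {M | M ∈ basisR U n m Δ Γ ∧ OrderLE U k M} := by
  have hT := entry_maps hD i j
  obtain ⟨f, hf, hfD⟩ := entry_eq_diffOp hD hk i j
  rw [hfD] at hT ⊢
  by_cases hij : i = j
  · subst hij
    refine single_mem_of_mem_span ?_ (diffOp_mem_span_products
      (BX := family (mulOp U (x U)) (dx U) (fun α => mulOp U (x U) ^ α) (xPar n Δ i) .plus 0 0)
      (BY := family (mulOp U (y U)) (dy U) (fun β => mulOp U (y U) ^ β) (yPar m Γ i) .plus 0 0)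
      ?_ ?_ (k + 1) f hf hT)
    · rintro _ ⟨a, b, hab, P, hP, P', hP', rfl⟩
      exact single_self_mem (Nat.lt_succ_iff.1 hab) hP hP'
    · intro a u _ _ hu
      rw [xPar_eq hΔ]
      exact exists_raising_x U (Δ := 0) (by omega)
    · intro b v _ _ hv
      rw [yPar_eq hΓ]
      exact exists_raising_y U (Δ := 0) (by omega)
  · obtain ⟨ε, rfl, rfl⟩ : ∃ ε : Sgn, i = ε.row ∧ j = ε.col := by
      fin_cases i <;> fin_cases j
      · exact absurd rfl hij
      · exact ⟨.plus, rfl, rfl⟩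
      · exact ⟨.minus, rfl, rfl⟩
      · exact absurd rfl hij
    refine single_mem_of_mem_span ?_ (diffOp_mem_span_products
      (fun a u _ => exists_family_x U hΔ ε a u) (fun b v _ => exists_family_y U hΓ ε b v)
      (k + 1) f hf hT)
    rintro _ ⟨a, b, hab, P, hP, P', hP', rfl⟩
    exact Submodule.subset_span ⟨single_mem_basisR hP hP', orderLE_single _ _
      (isDiffOpOn_mul (Nat.lt_succ_iff.1 hab)
        (family_subset_ordLT (dx_mul_x U) (fun α hα => exists_hasLead_factorX U n Δ ε hα) hP)
        (family_subset_ordLT (dy_mul_y U) (fun β hβ => exists_hasLead_factorY U m Γ ε hβ) hP'))⟩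

end RectMod

end

theorem mainTheorem10 (U : TopologicalSpace.Opens (ℂ × ℂ)) (n m Δ Γ : ℕ)
    (hΔ : Δ ≤ n) (hΓ : Γ ≤ m) (k : ℕ) (D : RectMod.MatOp U)
    (hD : D ∈ RectMod.complementR U n m Δ Γ) (hk : RectMod.OrderLE U k D) :
    D ∈ Submodule.span ℂ {M | M ∈ RectMod.basisR U n m Δ Γ ∧ RectMod.OrderLE U k M} := by
  rw [Matrix.matrix_eq_sum_single D]
  exact sum_mem fun i _ => sum_mem fun j _ => RectMod.single_entry_mem hΔ hΓ hD hk i j
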